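/- Let $\mathbb T\subseteq\mathbb R$ be a time scale (a closed set) with $0\in\mathbb T$, forward jump $\sigma$, graininess $\mu(t)=\sigma(t)-t$, delta derivative $f^\Delta$ and delta integral $\int f\,\Delta s$; write $J_{\mathbb T}=J\cap\mathbb T$ for an interval $J$. Let $n\in\mathbb N$, $\tau_1,\tau_2>0$, $\tau=\max\{\tau_1,\tau_2\}$, $\beta\ge 0$, and assume that $t-\tau_1,\ t-\tau_2,\ t-\beta\in\mathbb T$ for all $t\in[0,\infty)_{\mathbb T}$, and that $\sigma(t-\beta)=\sigma(t)-\beta$ for all $t\in[\beta,\infty)_{\mathbb T}$. Let $\mathcal P,\mathcal Q,\mathcal R\in\mathbb R^{n\times n}$, $I\in\mathbb R^n$, $\Gamma(x)=\mathrm{diag}\{\Gamma_1(x),\dots,\Gamma_n(x)\}$, and $\Upsilon,\mathcal F:\mathbb R^n\to\mathbb R^n$. For $K\in\mathbb R^{n\times n}$ consider the drive and the response Cohen–Grossberg networks $$x^\Delta(t)=-\Gamma(x(t))\Big[\Upsilon(x(t))-\mathcal P\mathcal F(x(t))-\mathcal Q\mathcal F(x(t-\tau_1))-\mathcal R\int_{t-\tau_2}^t\mathcal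 F(x(s))\Delta s-I\Big],\quad t\in[0,\infty)_{\mathbb T},$$ $$y^\Delta(t)=-\Gamma(y(t))\Big[\Upsilon(y(t))-\mathcal P\mathcal F(y(t))-\mathcal Q\mathcal F(y(t-\tau_1))-\mathcal R\int_{t-\tau_2}^t\mathcal F(y(s))\Delta s-I\Big]+u(t),\quad t\in[0,\infty)_{\mathbb T},$$ with $u(t)=-K\,(y(t)-x(t-\beta))$, $x=\phi$ and $y=\psi$ on $[-\tau,0]_{\mathbb T}$, where $\phi,\psi$ are rd-continuous, and $x(s)=\phi(-\tau)$ for $s\in[-\tau-\beta,-\tau]_{\mathbb T}$. The delta derivatives are those of the time scale $[0,\infty)_{\mathbb T}$ (so one-sided at $0$). Let $p\in\{1,2,\infty\}$ and let $\|\cdot\|_p$ be the $p$-norm of vectors and the induced norm of matrices. Assume that there are positive constants $L_\Gamma,L_\Upsilon,L_{\mathcal F},M_\Gamma,M_\Upsilon,M_{\mathcal F}$ such that for all $x,y\in\mathbb R^n$ $$\|\Gamma(x)-\Gamma(y)\|_p\le L_\Gamma\|x-y\|_p,\quad \|\Upsilon(x)-\Upsilon(y)\|_p\le L_\Upsilon\|x-y\|_p,\quad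 \|\mathcal F(x)-\mathcal F(y)\|_p\le L_{\mathcal F}\|x-y\|_p,$$ $$\|\Gamma(x)\|_p\le M_\Gamma,\quad \|\Upsilon(x)\|_p\le M_\Upsilon,\quad \|\mathcal F(x)\|_p\le M_{\mathcal F}.$$ For $W\in\mathbb R^{n\times n}$ let $\Lambda_p(W)=\lim_{h\to0^+}(\|\mathrm{Id}+hW\|_p-1)/h$, and let $M_p(W,\mathbb T)$ be the supremum of the numbers $(\|\mathrm{Id}+\mu(t)W\|_p-1)/\mu(t)$ over $t\in\mathbb T$ with $\mu(t)>0$, together with $\Lambda_p(W)$ if $\mu(t)=0$ for some $t\in\mathbb T$. For a nonsingular $Z\in\mathbb R^{n\times n}$ put $$\mathcal M_1^p=-\Big(M_p(-ZKZ^{-1},\mathbb T)+\|Z\|_p\|Z^{-1}\|_p\big((M_\Gamma L_\Upsilon+M_\Upsilon L_\Gamma)+(M_\Gamma L_{\mathcal F}+M_{\mathcal F}L_\Gamma)\|\mathcal P\|_p+L_\Gamma\|I\|_p\big)\Big),$$ $$\mathcal M_2^p=\|Z\|_p\|Z^{-1}\|_p\,(M_\Gamma L_{\mathcal F}+M_{\mathcal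 F}L_\Gamma)\,(\|\mathcal Q\|_p+\tau\|\mathcal R\|_p).$$ Theorem. If $\mathcal M_1^p-\mathcal M_2^p>0$ and $-\mathcal M_1^p$ is positively regressive, i.e. $1-\mu(t)\mathcal M_1^p>0$ for all $t\in\mathbb T$, then the drive and response networks are exponentially lag synchronized: there is $\nu>0$ such that for all rd-continuous $\phi,\psi$ and all solutions $x,y$ there is $C>0$ with $$\|y(t)-x(t-\beta)\|_p\le C\,e_{\ominus\nu}(t,0)\qquad\text{for all } t\in[0,\infty)_{\mathbb T},$$ where $e_q(t,s)$ is the time scale exponential function and $(\ominus\nu)(t)=-\nu/(1+\mu(t)\nu)$. -/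

import Mathlib

open Set Filter Topology MeasureTheory
open scoped ENNReal

noncomputable section

namespace TimeScale

/-- Forward jump `σ(t) = inf {s ∈ T : s > t}`. If no point of `T` lies beyond `t`, then
`σ(t) = inf ∅ = sup T`, which for `t ∈ T` is `t` itself. -/
def sigma (T : Set ℝ) (t : ℝ) : ℝ :=
  open Classical in if (T ∩ Ioi t).Nonempty then sInf (T ∩ Ioi t) else t

/-- Backward jump `ρ(t) = sup {s ∈ T : s < t}`, with `ρ(t) = t` at the minimum of `T`. -/
def rho (T : Set ℝ) (t : ℝ) : ℝ :=
  open Classical in if (T ∩ Iio t).Nonempty then sSup (T ∩ Iio t) else t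

/-- Graininess `μ(t) = σ(t) - t`. -/
def mu (T : Set ℝ) (t : ℝ) : ℝ := sigma T t - t

/-- `t` is a right-dense point of `T`: `t < max T` and `σ(t) = t`. -/
def IsRightDense (T : Set ℝ) (t : ℝ) : Prop :=
  t ∈ T ∧ (T ∩ Ioi t).Nonempty ∧ sigma T t = t

/-- `t` is a left-dense point of `T`: `t > min T` and `ρ(t) = t`. -/
def IsLeftDense (T : Set ℝ) (t : ℝ) : Prop :=
  t ∈ T ∧ (T ∩ Iio t).Nonempty ∧ rho T t = t

/-- `f` has delta derivative `f'` at the point `t` of the time scale `T`. (At a left-scattered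
maximum of `T`, where the delta derivative is not considered, this holds for every `f'`.) -/
def HasDeltaDerivAt {E : Type*} [NormedAddCommGroup E] [NormedSpace ℝ E]
    (T : Set ℝ) (f : ℝ → E) (f' : E) (t : ℝ) : Prop :=
  ∀ ε > 0, ∀ᶠ s in 𝓝[T] t,
    ‖(f (sigma T t) - f s) - (sigma T t - s) • f'‖ ≤ ε * |sigma T t - s|

/-- `f` is rd-continuous on `T`: continuous at right-dense points, with finite left-sided limits
at left-dense points. Only the values of `f` on `T` matter. -/
def RdContinuous {E : Type*} [TopologicalSpace E] (T : Set ℝ) (f : ℝ → E) : Prop :=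
  (∀ t, IsRightDense T t → ContinuousWithinAt f T t) ∧
  (∀ t, IsLeftDense T t → ∃ l, Tendsto f (𝓝[T ∩ Iio t] t) (𝓝 l))

/-- The last point of `T` that is not later than `s`. -/
def floor (T : Set ℝ) (s : ℝ) : ℝ := sSup (T ∩ Iic s)

/-- The delta integral `∫_a^b f(s) Δs` for `a, b ∈ T`: the Lebesgue integral of the extension of
`f` from `T` to the real line that is constant on every gap `[u, σ(u))`. A right-scattered point
`u` thus contributes `μ(u) f(u)`, and on the rest of `T` the integral is the usual one.
`deltaIntegral_eq_sub` below: it equals `F(b) - F(a)` for every antiderivative `F` of an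
rd-continuous `f`. -/
def deltaIntegral {E : Type*} [NormedAddCommGroup E] [NormedSpace ℝ E]
    (T : Set ℝ) (f : ℝ → E) (a b : ℝ) : E :=
  ∫ s in a..b, f (floor T s)

section Calculus

variable {T : Set ℝ}

theorem floor_eq_self {t : ℝ} (ht : t ∈ T) : floor T t = t :=
  IsGreatest.csSup_eq ⟨⟨ht, le_refl t⟩, fun _ h => h.2⟩

theorem floor_spec (hT : IsClosed T) {a s : ℝ} (ha : a ∈ T) (has : a ≤ s) :
    floor T s ∈ T ∧ a ≤ floor T s ∧ floor T s ≤ s ∧ ∀ w ∈ T, w ≤ s → w ≤ floor T s := by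
  have hb : BddAbove (T ∩ Iic s) := ⟨s, fun _ h => h.2⟩
  have hm : floor T s ∈ T ∩ Iic s :=
    (hT.inter isClosed_Iic).csSup_mem ⟨a, ha, has⟩ hb
  exact ⟨hm.1, le_csSup hb ⟨ha, has⟩, hm.2, fun w hw hws => le_csSup hb ⟨hw, hws⟩⟩

/-- The gap of `T` around a point `s ∉ T`. -/
theorem exists_gap (hT : IsClosed T) {a b s : ℝ} (ha : a ∈ T) (hb : b ∈ T) (has : a ≤ s)
    (hsb : s ≤ b) (hs : s ∉ T) :
    ∃ u ∈ T, ∃ v ∈ T, u < s ∧ s < v ∧ sigma T u = v ∧ (∀ w ∈ T, w ≤ u ∨ v ≤ w) ∧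
      ∀ r, u ≤ r → r < v → floor T r = u := by
  obtain ⟨hu, hau, hus, hmax⟩ := floor_spec hT ha has
  have hus' : floor T s < s := lt_of_le_of_ne hus fun h => hs (h ▸ hu)
  have hbd : BddBelow (T ∩ Ioi (floor T s)) := ⟨floor T s, fun _ h => le_of_lt h.2⟩
  have hbd' : BddBelow (T ∩ Ici s) := ⟨s, fun _ h => h.2⟩
  have heq : T ∩ Ioi (floor T s) = T ∩ Ici s := by
    ext w
    constructor
    · rintro ⟨hw, hw'⟩
      refine ⟨hw, ?_⟩
      by_contra hc
      exact absurd (hmax w hw (le_of_lt (not_le.1 hc))) (not_le.2 hw')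
    · rintro ⟨hw, hw'⟩
      exact ⟨hw, lt_of_lt_of_le hus' hw'⟩
  have hne : (T ∩ Ioi (floor T s)).Nonempty := ⟨b, hb, lt_of_lt_of_le hus' hsb⟩
  have hsig : sigma T (floor T s) = sInf (T ∩ Ici s) := by
    unfold sigma
    rw [if_pos hne, heq]
  have hv : sInf (T ∩ Ici s) ∈ T ∩ Ici s :=
    (hT.inter isClosed_Ici).csInf_mem ⟨b, hb, hsb⟩ hbd'
  have hdich : ∀ w ∈ T, w ≤ floor T s ∨ sInf (T ∩ Ici s) ≤ w := by
    intro w hw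
    rcases le_total w s with h | h
    · exact Or.inl (hmax w hw h)
    · exact Or.inr (csInf_le hbd' ⟨hw, h⟩)
  refine ⟨floor T s, hu, sInf (T ∩ Ici s), hv.1, hus',
    lt_of_le_of_ne hv.2 fun h => hs (h ▸ hv.1), hsig, hdich, ?_⟩
  intro r hr hr'
  refine IsGreatest.csSup_eq ⟨⟨hu, hr⟩, ?_⟩
  rintro w ⟨hw, hwr⟩
  rcases hdich w hw with h | h
  · exact h
  · exact absurd (lt_of_le_of_lt (le_trans h hwr) hr') (lt_irrefl _)

variable {E : Type*} [NormedAddCommGroup E]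

theorem HasDeltaDerivAt.sigma_eq [NormedSpace ℝ E] {f : ℝ → E} {f' : E} {t : ℝ} (h : HasDeltaDerivAt T f f' t)
    (ht : t ∈ T) : f (sigma T t) = f t + (sigma T t - t) • f' := by
  have key : ‖(f (sigma T t) - f t) - (sigma T t - t) • f'‖ ≤ 0 := by
    refine le_of_forall_pos_le_add fun ε hε => ?_
    have hpos : 0 < |sigma T t - t| + 1 := by positivity
    have h1 := (h (ε / (|sigma T t - t| + 1)) (by positivity)).self_of_nhdsWithin ht
    refine h1.trans ?_
    rw [zero_add, div_mul_eq_mul_div, div_le_iff₀ hpos]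
    nlinarith [abs_nonneg (sigma T t - t)]
  have h2 := norm_le_zero_iff.1 key
  rw [sub_eq_zero, sub_eq_iff_eq_add] at h2
  rw [h2, add_comm]

theorem HasDeltaDerivAt.continuousWithinAt [NormedSpace ℝ E] {f : ℝ → E} {f' : E} {t : ℝ}
    (h : HasDeltaDerivAt T f f' t) (ht : t ∈ T) : ContinuousWithinAt f T t := by
  rw [Metric.continuousWithinAt_iff']
  intro ε hε
  have hD : 0 < |sigma T t - t| + 1 := by positivity
  have h1 := h (ε / 2 / (|sigma T t - t| + 1)) (by positivity)
  have h2 : ∀ᶠ s in 𝓝[T] t, |t - s| < 1 ∧ |t - s| * ‖f'‖ < ε / 2 := by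
    have hc : Tendsto (fun s : ℝ => |t - s|) (𝓝[T] t) (𝓝 0) := by
      have : Continuous fun s : ℝ => |t - s| := by fun_prop
      simpa using (this.tendsto t).mono_left nhdsWithin_le_nhds
    have hc' : Tendsto (fun s : ℝ => |t - s| * ‖f'‖) (𝓝[T] t) (𝓝 0) := by
      simpa using hc.mul_const ‖f'‖
    exact (hc.eventually_lt_const one_pos).and (hc'.eventually_lt_const (by positivity))
  filter_upwards [h1, h2] with s hs hs2
  have e : f s - f t = -((f (sigma T t) - f s) - (sigma T t - s) • f') - (t - s) • f' := by
    rw [h.sigma_eq ht]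
    module
  rw [dist_eq_norm, e]
  have hb : |sigma T t - s| ≤ |sigma T t - t| + 1 := by
    have := abs_sub_le (sigma T t) t s
    linarith [hs2.1]
  have h3 : ε / 2 / (|sigma T t - t| + 1) * |sigma T t - s| ≤ ε / 2 := by
    rw [div_mul_eq_mul_div, div_le_iff₀ hD]
    exact mul_le_mul_of_nonneg_left hb (by positivity)
  calc ‖-((f (sigma T t) - f s) - (sigma T t - s) • f') - (t - s) • f'‖
      ≤ ‖(f (sigma T t) - f s) - (sigma T t - s) • f'‖ + ‖(t - s) • f'‖ := by
        refine (norm_sub_le _ _).trans_eq ?_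
        rw [norm_neg]
    _ < ε := by
        rw [norm_smul, Real.norm_eq_abs]
        linarith [hs2.2]

/-- An rd-continuous function is bounded on compact intervals of the time scale. -/
theorem RdContinuous.bounded {f : ℝ → E} (hT : IsClosed T) (hf : RdContinuous T f) (a b : ℝ) :
    ∃ B, ∀ t ∈ T ∩ Icc a b, ‖f t‖ ≤ B := by
  have hK : IsCompact (T ∩ Icc a b) := (isCompact_Icc).inter_left hT
  refine hK.induction_on (p := fun S => ∃ B, ∀ t ∈ S, ‖f t‖ ≤ B) ⟨0, by simp⟩ ?_ ?_ ?_
  · rintro s t hst ⟨B, hB⟩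
    exact ⟨B, fun x hx => hB x (hst hx)⟩
  · rintro s t ⟨B, hB⟩ ⟨B', hB'⟩
    refine ⟨max B B', fun x hx => ?_⟩
    rcases hx with hx | hx
    · exact (hB x hx).trans (le_max_left _ _)
    · exact (hB' x hx).trans (le_max_right _ _)
  · intro t ht
    have loc : ∀ {l : Filter ℝ} {y : E}, Tendsto f l (𝓝 y) → ∀ᶠ s in l, ‖f s‖ ≤ ‖y‖ + 1 := by
      intro l y hl
      filter_upwards [hl.norm.eventually_lt_const (lt_add_one ‖y‖)] with s hs using hs.le
    have hR : ∃ B, ∀ᶠ s in 𝓝[T ∩ Ioi t] t, ‖f s‖ ≤ B := by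
      by_cases hrd : IsRightDense T t
      · exact ⟨_, loc ((hf.1 t hrd).tendsto.mono_left (nhdsWithin_mono t inter_subset_left))⟩
      · refine ⟨0, ?_⟩
        by_cases hne : (T ∩ Ioi t).Nonempty
        · have hbd : BddBelow (T ∩ Ioi t) := ⟨t, fun _ h => le_of_lt h.2⟩
          have hlt : t < sInf (T ∩ Ioi t) := by
            refine lt_of_le_of_ne (le_csInf hne fun _ h => le_of_lt h.2) fun h => hrd ⟨ht.1, hne, ?_⟩
            unfold sigma
            rw [if_pos hne, ← h]
          filter_upwards [mem_nhdsWithin_of_mem_nhds (Iio_mem_nhds hlt), self_mem_nhdsWithin]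
            with s hs hs'
          exact absurd (csInf_le hbd hs') (not_le.2 hs)
        · rw [not_nonempty_iff_eq_empty.1 hne]
          simp
    have hL : ∃ B, ∀ᶠ s in 𝓝[T ∩ Iio t] t, ‖f s‖ ≤ B := by
      by_cases hld : IsLeftDense T t
      · obtain ⟨l, hl⟩ := hf.2 t hld
        exact ⟨_, loc hl⟩
      · refine ⟨0, ?_⟩
        by_cases hne : (T ∩ Iio t).Nonempty
        · have hbd : BddAbove (T ∩ Iio t) := ⟨t, fun _ h => le_of_lt h.2⟩
          have hlt : sSup (T ∩ Iio t) < t := by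
            refine lt_of_le_of_ne (csSup_le hne fun _ h => le_of_lt h.2) fun h => hld ⟨ht.1, hne, ?_⟩
            unfold rho
            rw [if_pos hne, h]
          filter_upwards [mem_nhdsWithin_of_mem_nhds (Ioi_mem_nhds hlt), self_mem_nhdsWithin]
            with s hs hs'
          exact absurd (le_csSup hbd hs') (not_le.2 hs)
        · rw [not_nonempty_iff_eq_empty.1 hne]
          simp
    obtain ⟨B, hB⟩ := hR
    obtain ⟨B', hB'⟩ := hL
    refine ⟨{s | s ∈ T ∧ ‖f s‖ ≤ max (max B B') ‖f t‖}, ?_, max (max B B') ‖f t‖,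
      fun s hs => hs.2⟩
    have hmem : ∀ᶠ s in 𝓝[T ∩ Icc a b] t, s ∈ T ∧ ‖f s‖ ≤ max (max B B') ‖f t‖ := by
      rw [eventually_nhdsWithin_iff] at hB hB' ⊢
      filter_upwards [hB, hB'] with s h1 h2 hs
      refine ⟨hs.1, ?_⟩
      rcases lt_trichotomy s t with h | h | h
      · exact (h2 ⟨hs.1, h⟩).trans ((le_max_right _ _).trans (le_max_left _ _))
      · rw [h]; exact le_max_right _ _
      · exact (h1 ⟨hs.1, h⟩).trans ((le_max_left _ _).trans (le_max_left _ _))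
    exact hmem

/-- Fundamental theorem: the delta integral of an rd-continuous function is the increment of any
antiderivative. -/
theorem deltaIntegral_eq_sub [NormedSpace ℝ E] [CompleteSpace E] (hT : IsClosed T) {f F : ℝ → E} {a b : ℝ}
    (ha : a ∈ T) (hb : b ∈ T) (hab : a ≤ b) (hf : RdContinuous T f)
    (hF : ∀ t ∈ T, a ≤ t → t ≤ b → HasDeltaDerivAt T F (f t) t) :
    deltaIntegral T f a b = F b - F a := by
  set G : ℝ → E := fun s => F (floor T s) + (s - floor T s) • f (floor T s) with hG
  have hGT : ∀ t ∈ T, G t = F t := fun t ht => by simp [hG, floor_eq_self ht]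
  -- `G` is affine on the gaps
  have hGgap : ∀ u ∈ T, a ≤ u → u ≤ b → (∀ r, u ≤ r → r < sigma T u → floor T r = u) →
      sigma T u ∈ T → ∀ r, u ≤ r → r ≤ sigma T u → G r = F u + (r - u) • f u := by
    intro u hu hau hub hfl hv r hur hrv
    rcases hrv.lt_or_eq with h | h
    · simp only [hG, hfl r hur h]
    · rw [h, hGT _ hv]
      exact (hF u hu hau hub).sigma_eq hu
  -- every value of `G` is a convex combination of values of `F` on `T`
  have hconv : ∀ s, a ≤ s → s ≤ b → ∃ u ∈ T, ∃ v ∈ T, a ≤ u ∧ v ≤ b ∧ u ≤ s ∧ s ≤ v ∧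
      (∀ w ∈ T, w ≤ s → w ≤ u) ∧ (∀ w ∈ T, s ≤ w → v ≤ w) ∧
      ∃ α β : ℝ, 0 ≤ α ∧ 0 ≤ β ∧ α + β = 1 ∧ s = α * u + β * v ∧ G s = α • F u + β • F v := by
    intro s has hsb
    by_cases hs : s ∈ T
    · refine ⟨s, hs, s, hs, has, hsb, le_rfl, le_rfl, fun _ _ h => h, fun _ _ h => h, 1, 0,
        zero_le_one, le_rfl, by norm_num, by ring, ?_⟩
      simp [hGT s hs]
    · obtain ⟨u, hu, v, hv, hus, hsv, hsig, hd, hfl⟩ := exists_gap hT ha hb has hsb hs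
      have hau : a ≤ u := (hd a ha).resolve_right fun h => absurd (h.trans has) (not_le.2 hsv)
      have hvb : v ≤ b := (hd b hb).resolve_left fun h => absurd (hsb.trans h) (not_le.2 hus)
      have hub : u ≤ b := (hus.le.trans hsv.le).trans hvb
      have hvu : 0 < v - u := by linarith
      have hGs := hGgap u hu hau hub (by rwa [hsig]) (by rwa [hsig]) s hus.le (hsig ▸ hsv.le)
      have hFv := (hF u hu hau hub).sigma_eq hu
      rw [hsig] at hFv
      refine ⟨u, hu, v, hv, hau, hvb, hus.le, hsv.le, ?_, ?_, (v - s) / (v - u), (s - u) / (v - u),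
        div_nonneg (by linarith) hvu.le, div_nonneg (by linarith) hvu.le, ?_, ?_, ?_⟩
      · exact fun w hw hws => (hd w hw).resolve_right fun h => absurd (h.trans hws) (not_le.2 hsv)
      · exact fun w hw hws => (hd w hw).resolve_left fun h => absurd (hws.trans h) (not_le.2 hus)
      · field_simp; ring
      · field_simp; ring
      · rw [hGs, hFv, smul_add, ← add_assoc, ← add_smul, smul_smul]
        have e1 : (v - s) / (v - u) + (s - u) / (v - u) = 1 := by field_simp; ring
        have e2 : (s - u) / (v - u) * (v - u) = s - u := by field_simp
        rw [e1, e2, one_smul]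
  -- behaviour near a point of `T`: an estimate on `T` that is affine carries over to `G`
  have hlift : ∀ t ∈ T, a ≤ t → t ≤ b → ∀ (c : E) (ε : ℝ) (η : ℝ), 0 ≤ ε →
      ∀ w ∈ T, a ≤ w → w ≤ b →
      (∀ r ∈ T, r ∈ uIcc t w → ‖F r - F t - (r - t) • c‖ ≤ ε * |r - t| + η) →
      ∀ s ∈ uIcc t w, ‖G s - F t - (s - t) • c‖ ≤ ε * |s - t| + η := by
    intro t ht hat htb c ε η hε w hw haw hwb hest s hs
    have has : a ≤ s := (le_min hat haw).trans hs.1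
    have hsb : s ≤ b := hs.2.trans (max_le htb hwb)
    obtain ⟨u, hu, v, hv, hau, hvb, hus, hsv, hmax, hmin, α, β, hα, hβ, hαβ, hsc, hGs⟩ :=
      hconv s has hsb
    have hmT : min t w ∈ T := by rcases min_choice t w with h | h <;> rw [h] <;> assumption
    have hMT : max t w ∈ T := by rcases max_choice t w with h | h <;> rw [h] <;> assumption
    have hu1 : min t w ≤ u := hmax _ hmT hs.1
    have hv1 : v ≤ max t w := hmin _ hMT hs.2
    have hu2 := hest u hu ⟨hu1, hus.trans hs.2⟩
    have hv2 := hest v hv ⟨hs.1.trans hsv, hv1⟩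
    have habs : α * |u - t| + β * |v - t| = |s - t| := by
      rcases le_total t s with h | h
      · have := hmax t ht h
        rw [abs_of_nonneg (by linarith), abs_of_nonneg (by linarith), abs_of_nonneg (by linarith)]
        linear_combination -hsc - t * hαβ
      · have := hmin t ht h
        rw [abs_of_nonpos (by linarith), abs_of_nonpos (by linarith), abs_of_nonpos (by linarith)]
        linear_combination hsc + t * hαβ
    have e : G s - F t - (s - t) • c
        = α • (F u - F t - (u - t) • c) + β • (F v - F t - (v - t) • c) := by
      have hβ' : β = 1 - α := by linarith
      rw [hGs, hsc, hβ']
      module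
    rw [e]
    calc _ ≤ α * ‖F u - F t - (u - t) • c‖ + β * ‖F v - F t - (v - t) • c‖ := by
          refine (norm_add_le _ _).trans ?_
          rw [norm_smul, norm_smul, Real.norm_of_nonneg hα, Real.norm_of_nonneg hβ]
      _ ≤ α * (ε * |u - t| + η) + β * (ε * |v - t| + η) := by gcongr
      _ = ε * |s - t| + η := by rw [← habs]; linear_combination η * hαβ
  -- `G` is affine near a point outside `T`
  have hoff : ∀ s, a ≤ s → s ≤ b → s ∉ T → HasDerivAt G (f (floor T s)) s := by
    intro s has hsb hs
    obtain ⟨u, hu, v, hv, hus, hsv, hsig, hd, hfl⟩ := exists_gap hT ha hb has hsb hs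
    have hder : HasDerivAt (fun r : ℝ => F u + (r - u) • f u) (f (floor T s)) s := by
      rw [hfl s hus.le hsv]
      simpa using (((hasDerivAt_id s).sub_const u).smul_const (f u)).const_add (F u)
    refine hder.congr_of_eventuallyEq ?_
    filter_upwards [Ioo_mem_nhds hus hsv] with r hr
    simp only [hG, hfl r hr.1.le hr.2]
  have hright : ∀ s, a ≤ s → s < b → HasDerivWithinAt G (f (floor T s)) (Ioi s) s := by
    intro s has hsb
    by_cases hs : s ∈ T
    swap
    · exact (hoff s has hsb.le hs).hasDerivWithinAt
    have hne : (T ∩ Ioi s).Nonempty := ⟨b, hb, hsb⟩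
    have hbd : BddBelow (T ∩ Ioi s) := ⟨s, fun _ h => le_of_lt h.2⟩
    have hsig : sigma T s = sInf (T ∩ Ioi s) := by
      unfold sigma
      rw [if_pos hne]
    rw [floor_eq_self hs]
    rcases (le_csInf hne fun _ h => le_of_lt h.2 : s ≤ sInf (T ∩ Ioi s)).lt_or_eq with h | h
    · have hder : HasDerivWithinAt (fun r : ℝ => F s + (r - s) • f s) (f s) (Ioi s) s := by
        simpa using ((((hasDerivAt_id s).sub_const s).smul_const (f s)).const_add
          (F s)).hasDerivWithinAt
      refine hder.congr_of_eventuallyEq ?_ (by simp [hG, floor_eq_self hs])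
      filter_upwards [mem_nhdsWithin_of_mem_nhds (Iio_mem_nhds h), self_mem_nhdsWithin]
        with r hr hr'
      have : floor T r = s := by
        refine IsGreatest.csSup_eq ⟨⟨hs, (show s < r from hr').le⟩, ?_⟩
        rintro w ⟨hw, hwr⟩
        by_contra hc
        exact absurd (lt_of_le_of_lt ((csInf_le hbd ⟨hw, not_le.1 hc⟩).trans hwr) hr)
          (lt_irrefl _)
      simp only [hG, this]
    · rw [← h] at hsig
      rw [hasDerivWithinAt_iff_isLittleO, Asymptotics.isLittleO_iff]
      intro ε hε
      have h1 := hF s hs has hsb.le ε hε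
      rw [hsig, eventually_nhdsWithin_iff, Metric.eventually_nhds_iff] at h1
      obtain ⟨δ, hδ, h1⟩ := h1
      obtain ⟨w, ⟨hw, hsw⟩, hw'⟩ : ∃ w ∈ T ∩ Ioi s, w < min (s + δ) b :=
        exists_lt_of_csInf_lt hne (by rw [← h]; exact lt_min (by linarith) hsb)
      have hsw' : s < w := hsw
      filter_upwards [mem_nhdsWithin_of_mem_nhds (Iio_mem_nhds hsw), self_mem_nhdsWithin]
        with r hr hr'
      have hr1 : r < w := hr
      have hr2 : s < r := hr'
      rw [hGT s hs, Real.norm_eq_abs]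
      have := hlift s hs has hsb.le (f s) ε 0 hε.le w hw (has.trans hsw'.le)
        (hw'.le.trans (min_le_right _ _)) ?_ r ⟨?_, ?_⟩
      · simpa using this
      · intro q hq hqm
        rw [uIcc_of_le hsw'.le] at hqm
        have h2 := h1 (y := q) (by
          rw [Real.dist_eq, abs_of_nonneg (by linarith [hqm.1])]
          linarith [hqm.2, hw'.trans_le (min_le_left _ _)]) hq
        rw [abs_sub_comm, ← norm_neg] at h2
        rw [add_zero]
        have e : F q - F s - (q - s) • f s = -(F s - F q - (s - q) • f s) := by module
        rwa [e]
      · rw [inf_of_le_left hsw'.le]; exact hr2.le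
      · rw [sup_of_le_right hsw'.le]; exact hr1.le
  have hleft : ∀ s, a < s → s ≤ b → ContinuousWithinAt G (Iic s) s := by
    intro s has hsb
    by_cases hs : s ∈ T
    swap
    · exact (hoff s has.le hsb hs).continuousAt.continuousWithinAt
    by_cases hld : ∀ x < s, ∃ w ∈ T, x < w ∧ w < s
    · rw [Metric.continuousWithinAt_iff']
      intro ε hε
      have h1 := Metric.continuousWithinAt_iff.1
        ((hF s hs has.le hsb).continuousWithinAt hs) (ε / 2) (by positivity)
      obtain ⟨δ, hδ, h1⟩ := h1
      obtain ⟨w, hw, hw1, hw2⟩ := hld (max (s - δ) a) (max_lt (by linarith) has)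
      have hw3 : s - δ < w := (le_max_left _ _).trans_lt hw1
      have hw4 : a < w := (le_max_right _ _).trans_lt hw1
      filter_upwards [mem_nhdsWithin_of_mem_nhds (Ioi_mem_nhds hw2), self_mem_nhdsWithin]
        with r hr hr'
      have hr1 : w < r := hr
      have hr2 : r ≤ s := hr'
      have := hlift s hs has.le hsb 0 0 (ε / 2) le_rfl w hw hw4.le (hw2.le.trans hsb) ?_ r ⟨?_, ?_⟩
      · rw [dist_eq_norm, hGT s hs]
        have h3 : ‖G r - F s‖ ≤ ε / 2 := by simpa using this
        linarith
      · intro q hq hqm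
        rw [uIcc_of_ge hw2.le] at hqm
        have h2 := h1 hq (by
          rw [Real.dist_eq, abs_of_nonpos (by linarith [hqm.2])]
          linarith [hqm.1])
        rw [dist_eq_norm] at h2
        simpa using h2.le
      · rw [inf_of_le_right hw2.le]; exact hr1.le
      · rw [sup_of_le_left hw2.le]; exact hr2
    · push Not at hld
      obtain ⟨x, hx, hx'⟩ := hld
      have hxs : max x a < s := max_lt hx has
      obtain ⟨m, hm1, hm2⟩ := exists_between hxs
      have hxm : x < m := (le_max_left _ _).trans_lt hm1
      have ham : a < m := (le_max_right _ _).trans_lt hm1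
      have hm : m ∉ T := fun h => absurd (hx' m h hxm) (not_le.2 hm2)
      obtain ⟨u, hu, v, hv, hum, hmv, hsig, hd, hfl⟩ :=
        exists_gap hT ha hb ham.le (hm2.le.trans hsb) hm
      have hvs : v = s := le_antisymm
        ((hd s hs).resolve_left fun h => absurd (hm2.trans_le h) (not_lt.2 hum.le))
        (hx' v hv (hxm.trans hmv))
      have hau : a ≤ u := (hd a ha).resolve_right fun h => absurd (hmv.trans_le h) (not_lt.2 ham.le)
      have hus : u < s := hum.trans hm2
      rw [hvs] at hsig hfl
      have haff := hGgap u hu hau (hus.le.trans hsb) (by rwa [hsig]) (by rwa [hsig])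
      rw [hsig] at haff
      have hcont : ContinuousWithinAt (fun r : ℝ => F u + (r - u) • f u) (Iic s) s := by
        fun_prop
      refine hcont.congr_of_eventuallyEq ?_ (haff s hus.le le_rfl)
      filter_upwards [mem_nhdsWithin_of_mem_nhds (Ioi_mem_nhds hus), self_mem_nhdsWithin]
        with r hr hr'
      exact haff r (le_of_lt hr) hr'
  have hcont : ContinuousOn G (Icc a b) := by
    intro s hs
    have h1 : ContinuousWithinAt G (Icc a s) s := by
      rcases hs.1.lt_or_eq with h | h
      · exact (hleft s h hs.2).mono fun r hr => hr.2
      · rw [← h, Icc_self]; exact continuousWithinAt_singleton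
    have h2 : ContinuousWithinAt G (Icc s b) s := by
      rcases hs.2.lt_or_eq with h | h
      · exact (continuousWithinAt_Ioi_iff_Ici.1 (hright s hs.1 h).continuousWithinAt).mono
          fun r hr => hr.1
      · rw [h, Icc_self]; exact continuousWithinAt_singleton
    rw [← Icc_union_Icc_eq_Icc hs.1 hs.2]
    exact h1.union h2
  have hint : IntervalIntegrable (fun s => f (floor T s)) volume a b := by
    obtain ⟨B, hB⟩ := hf.bounded hT a b
    rw [intervalIntegrable_iff_integrableOn_Ioo_of_le hab]
    refine ⟨?_, .restrict_of_bounded (C := B) (by simp) ?_⟩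
    · refine (aestronglyMeasurable_derivWithin_Ioi G _).congr ?_
      filter_upwards [ae_restrict_mem measurableSet_Ioo] with s hs
      exact (hright s hs.1.le hs.2).derivWithin (uniqueDiffWithinAt_Ioi s)
    · refine (ae_restrict_mem measurableSet_Ioo).mono fun s hs => ?_
      obtain ⟨h1, h2, h3, -⟩ := floor_spec hT ha hs.1.le
      exact hB _ ⟨h1, h2, h3.trans hs.2.le⟩
  unfold deltaIntegral
  rw [intervalIntegral.integral_eq_sub_of_hasDeriv_right_of_le hab hcont
    (fun s hs => hright s hs.1.le hs.2) hint, hGT b hb, hGT a ha]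

end Calculus

/-- `f` is positively regressive on `T`. -/
def PosRegressive (T : Set ℝ) (f : ℝ → ℝ) : Prop := ∀ t ∈ T, 0 < 1 + mu T t * f t

/-- `(⊖ q)(t) = - q(t) / (1 + μ(t) q(t))`. -/
def ominus (T : Set ℝ) (q : ℝ → ℝ) : ℝ → ℝ := fun t => - q t / (1 + mu T t * q t)

/-- The cylinder transformation `ζ_h(z)`. -/
def cyl (h z : ℝ) : ℝ := if h = 0 then z else Real.log (1 + z * h) / h

/-- The time scale exponential `e_q(t, s) = exp (∫_s^t ζ_{μ(z)}(q(z)) Δz)`. -/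
def texp (T : Set ℝ) (q : ℝ → ℝ) (t s : ℝ) : ℝ :=
  Real.exp (deltaIntegral T (fun z => cyl (mu T z) (q z)) s t)

end TimeScale

namespace CohenGrossberg

open TimeScale

/-- The `p`-norm of a vector. -/
def vnorm (p : ℝ≥0∞) [Fact (1 ≤ p)] {n : ℕ} (v : Fin n → ℝ) : ℝ := ‖WithLp.toLp p v‖

/-- The `p`-norm of a matrix: the operator norm induced by the vector `p`-norm. -/
def mnorm (p : ℝ≥0∞) [Fact (1 ≤ p)] {n : ℕ} (W : Matrix (Fin n) (Fin n) ℝ) : ℝ :=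
  ‖LinearMap.toContinuousLinearMap (Matrix.toLpLin p p W)‖

/-- The generalized matrix measure `ω_p(W, h) = (‖1 + h W‖_p - 1) / h`, for `h > 0`. -/
def genMeasure (p : ℝ≥0∞) [Fact (1 ≤ p)] {n : ℕ} (W : Matrix (Fin n) (Fin n) ℝ) (h : ℝ) : ℝ :=
  (mnorm p (1 + h • W) - 1) / h

/-- The classical matrix measure `Λ_p(W) = lim_{h → 0+} (‖1 + h W‖_p - 1) / h`. -/
def logNorm (p : ℝ≥0∞) [Fact (1 ≤ p)] {n : ℕ} (W : Matrix (Fin n) (Fin n) ℝ) : ℝ :=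
  limUnder (𝓝[>] (0 : ℝ)) (genMeasure p W)

/-- The unified matrix measure `M_p(W, T)`: the largest (supremum) of the numbers
`ω_p(W, μ(t))`, `t ∈ T`, `μ(t) > 0`, together with `Λ_p(W)` unless `μ > 0` on all of `T`. -/
def unifiedMeasure (p : ℝ≥0∞) [Fact (1 ≤ p)] {n : ℕ} (W : Matrix (Fin n) (Fin n) ℝ)
    (T : Set ℝ) : ℝ :=
  sSup ({r | ∃ t ∈ T, 0 < mu T t ∧ r = genMeasure p W (mu T t)} ∪
    {r | (∃ t ∈ T, mu T t = 0) ∧ r = logNorm p W})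

/-- The data of a network of `n` neurons. `amp x` is the list of diagonal entries of `Γ(x)`,
`beh` is `Υ`, `act` is the activation `F`; `P`, `Q`, `R` are the connection matrices, `bias` the
external input, and `τ₁`, `τ₂` the discrete and the distributed delay. -/
structure Network (n : ℕ) where
  amp : (Fin n → ℝ) → (Fin n → ℝ)
  beh : (Fin n → ℝ) → (Fin n → ℝ)
  act : (Fin n → ℝ) → (Fin n → ℝ)
  P : Matrix (Fin n) (Fin n) ℝ
  Q : Matrix (Fin n) (Fin n) ℝ
  R : Matrix (Fin n) (Fin n) ℝ
  bias : Fin n → ℝ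
  τ₁ : ℝ
  τ₂ : ℝ

namespace Network

variable {n : ℕ}

/-- `Γ(x) = diag {Γ₁(x), …, Γₙ(x)}`. -/
def Gam (N : Network n) (x : Fin n → ℝ) : Matrix (Fin n) (Fin n) ℝ := Matrix.diagonal (N.amp x)

/-- `τ = max {τ₁, τ₂}`. -/
def τ (N : Network n) : ℝ := max N.τ₁ N.τ₂

/-- The right-hand side
`- Γ(x(t)) [Υ(x(t)) - P F(x(t)) - Q F(x(t - τ₁)) - R ∫_{t-τ₂}^t F(x(s)) Δs - bias]`. -/
def field (N : Network n) (T : Set ℝ) (x : ℝ → Fin n → ℝ) (t : ℝ) : Fin n → ℝ :=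
  - (N.Gam (x t)).mulVec (N.beh (x t) - N.P.mulVec (N.act (x t))
      - N.Q.mulVec (N.act (x (t - N.τ₁)))
      - N.R.mulVec (deltaIntegral T (fun s => N.act (x s)) (t - N.τ₂) t) - N.bias)

/-- `x` solves the drive system with initial function `φ` on `[-τ, 0]_T`, and is continued
constantly, by `φ(-τ)`, to `[-τ-β, -τ]_T`. The delta derivative is that of the time scale
`[0, ∞)_T`, so that at `t = 0` the initial function does not enter it. -/
structure IsDrive (N : Network n) (T : Set ℝ) (β : ℝ) (φ x : ℝ → Fin n → ℝ) : Prop where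
  eqn : ∀ t ∈ T, 0 ≤ t → HasDeltaDerivAt (T ∩ Ici 0) x (N.field T x t) t
  init : ∀ s ∈ T, -N.τ ≤ s → s ≤ 0 → x s = φ s
  past : ∀ s ∈ T, -N.τ - β ≤ s → s ≤ -N.τ → x s = φ (-N.τ)

/-- `y` solves the response system with initial function `ψ` on `[-τ, 0]_T`, driven by `x` through
the feedback `u(t) = -K (y(t) - x(t - β))`. -/
structure IsResponse (N : Network n) (T : Set ℝ) (β : ℝ) (K : Matrix (Fin n) (Fin n) ℝ)
    (x ψ y : ℝ → Fin n → ℝ) : Prop where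
  eqn : ∀ t ∈ T, 0 ≤ t →
    HasDeltaDerivAt (T ∩ Ici 0) y (N.field T y t - K.mulVec (y t - x (t - β))) t
  init : ∀ s ∈ T, -N.τ ≤ s → s ≤ 0 → y s = ψ s

/-- Exponential lag synchronization, with respect to the `p`-norm and initial time `0`. The rate
`ν` is common to all initial functions and solutions. -/
def ExpLagSync (p : ℝ≥0∞) [Fact (1 ≤ p)] (N : Network n) (T : Set ℝ) (β : ℝ)
    (K : Matrix (Fin n) (Fin n) ℝ) : Prop :=
  ∃ ν > 0, ∀ φ ψ x y : ℝ → Fin n → ℝ,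
    RdContinuous (T ∩ Icc (-N.τ) 0) φ → RdContinuous (T ∩ Icc (-N.τ) 0) ψ →
    N.IsDrive T β φ x → N.IsResponse T β K x ψ y →
    ∃ C > 0, ∀ t ∈ T, 0 ≤ t →
      vnorm p (y t - x (t - β)) ≤ C * texp T (ominus T fun _ => ν) t 0

end Network

/-- Lipschitz constants `LΓ`, `LΥ`, `LF` and bounds `MΓ`, `MΥ`, `MF`. -/
structure Consts where
  LΓ : ℝ
  LΥ : ℝ
  LF : ℝ
  MΓ : ℝ
  MΥ : ℝ
  MF : ℝ

/-- In the `p`-norm, `Γ`, `Υ`, `F` are Lipschitz with the (positive) constants `LΓ`, `LΥ`, `LF`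
and bounded by the (positive) constants `MΓ`, `MΥ`, `MF`. -/
structure Consts.Admissible (c : Consts) (p : ℝ≥0∞) [Fact (1 ≤ p)] {n : ℕ} (N : Network n) :
    Prop where
  LΓ_pos : 0 < c.LΓ
  LΥ_pos : 0 < c.LΥ
  LF_pos : 0 < c.LF
  MΓ_pos : 0 < c.MΓ
  MΥ_pos : 0 < c.MΥ
  MF_pos : 0 < c.MF
  lip_amp : ∀ x y, mnorm p (N.Gam x - N.Gam y) ≤ c.LΓ * vnorm p (x - y)
  lip_beh : ∀ x y, vnorm p (N.beh x - N.beh y) ≤ c.LΥ * vnorm p (x - y)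
  lip_act : ∀ x y, vnorm p (N.act x - N.act y) ≤ c.LF * vnorm p (x - y)
  bdd_amp : ∀ x, mnorm p (N.Gam x) ≤ c.MΓ
  bdd_beh : ∀ x, vnorm p (N.beh x) ≤ c.MΥ
  bdd_act : ∀ x, vnorm p (N.act x) ≤ c.MF

/-- The constant `M₁^p`. -/
def M₁ (p : ℝ≥0∞) [Fact (1 ≤ p)] {n : ℕ} (N : Network n) (c : Consts) (T : Set ℝ)
    (Z K : Matrix (Fin n) (Fin n) ℝ) : ℝ :=
  -(unifiedMeasure p (-(Z * K * Z⁻¹)) T + mnorm p Z * mnorm p Z⁻¹ *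
    ((c.MΓ * c.LΥ + c.MΥ * c.LΓ) + (c.MΓ * c.LF + c.MF * c.LΓ) * mnorm p N.P
      + c.LΓ * vnorm p N.bias))

/-- The constant `M₂^p`. -/
def M₂ (p : ℝ≥0∞) [Fact (1 ≤ p)] {n : ℕ} (N : Network n) (c : Consts)
    (Z : Matrix (Fin n) (Fin n) ℝ) : ℝ :=
  mnorm p Z * mnorm p Z⁻¹ * (c.MΓ * c.LF + c.MF * c.LΓ) * (mnorm p N.Q + N.τ * mnorm p N.R)

end CohenGrossberg

end

/-! Put `e(t) = y(t) - x(t-β)` and `v = Z e`. From time `β` on, both networks obey their equations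
and the shift commutes with `σ`, so `v^Δ = W v + Z g` with `W = -Z K Z⁻¹` and `g` the difference of
the two fields. The Lipschitz constants and bounds control `Z g` by a multiple of `‖v(t)‖` plus `M₂`
times any bound of `‖v‖` on `[t-τ, t]`. The matrix measure controls the linear part: an Euler step
of length `h` multiplies the norm by at most `‖1 + h W‖ = 1 + h ω(W, h)`. At a right-scattered point
the step `h = μ(t)` is exact; at a right-dense point it is correct up to `o(h)`, and `ω(W, h)` tends
to `Λ(W)`. Hence `V = ‖v‖` satisfies the Halanay inequality `V^Δ ≤ -M₁ V + M₂ sup_{[t-τ,t]} V`.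

By continuity some `ν > 0` has `M₂ e^{ντ} + ν < M₁`. The bound `V ≤ C e^{-νt}` then propagates: if
it holds up to `t`, where the right-hand side is `w`, then a step `h` leads to at most `(1 - h M₁) w
+ h M₂ e^{ντ} w ≤ (1 - νh) w ≤ e^{-νh} w`. Positive regressivity gives the nonnegative coefficient
`1 - h M₁` at the jumps. `scale_induction` makes this rigorous in `halanay`; `vnorm_sigma_le`,
`eventually_vnorm_le` and `vnorm_field_sub_le` supply its hypotheses. Finally `e^{-νt} ≤ e_{⊖ν}(t,
0)`, because `log(1 + μν) ≤ μν`. -/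

namespace TimeScale

/-! ### Forward jumps and induction along a time scale. -/

section Induction

variable {T : Set ℝ}

theorem sigma_le {t s : ℝ} (hs : s ∈ T) (hts : t < s) : sigma T t ≤ s := by
  unfold sigma
  rw [if_pos ⟨s, hs, hts⟩]
  exact csInf_le ⟨t, fun _ h => le_of_lt h.2⟩ ⟨hs, hts⟩

theorem le_sigma (T : Set ℝ) (t : ℝ) : t ≤ sigma T t := by
  unfold sigma
  split_ifs with h
  · exact le_csInf h fun _ h => le_of_lt h.2
  · exact le_rfl

theorem sigma_eq_of_isLeast {t s : ℝ} (h : IsLeast (T ∩ Ioi t) s) : sigma T t = s := by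
  unfold sigma
  rw [if_pos ⟨s, h.1⟩, h.csInf_eq]

/-- The networks live on `[0, ∞)_T` and the error on `[β, ∞)_T`; cutting off the past does not
affect the jump. -/
theorem sigma_inter_Ici {a t : ℝ} (hat : a ≤ t) : sigma (T ∩ Ici a) t = sigma T t := by
  have : T ∩ Ici a ∩ Ioi t = T ∩ Ioi t := by
    ext w
    simp only [mem_inter_iff, mem_Ici, mem_Ioi]
    exact ⟨fun h => ⟨h.1.1, h.2⟩, fun h => ⟨⟨h.1, hat.trans h.2.le⟩, h.2⟩⟩
  unfold sigma
  rw [this]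

theorem mu_nonneg (T : Set ℝ) (t : ℝ) : 0 ≤ mu T t := sub_nonneg.2 (le_sigma T t)

theorem IsLeftDense.neBot {t : ℝ} (h : IsLeftDense T t) : (𝓝[T ∩ Iio t] t).NeBot := by
  obtain ⟨-, hne, hr⟩ := h
  rw [← mem_closure_iff_nhdsWithin_neBot]
  have := csSup_mem_closure hne ⟨t, fun _ h => le_of_lt h.2⟩
  unfold rho at hr
  rwa [if_pos hne, ← hr.symm] at *

/-- Induction along a time scale. -/
theorem scale_induction (hT : IsClosed T) {a : ℝ} {q : ℝ → Prop} (h0 : q a)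
    (hσ : ∀ t ∈ T, a ≤ t → (∀ s ∈ T, a ≤ s → s ≤ t → q s) → q (sigma T t))
    (hr : ∀ t ∈ T, a ≤ t → sigma T t = t → (∀ s ∈ T, a ≤ s → s ≤ t → q s) →
      ∀ᶠ s in 𝓝[T ∩ Ioi t] t, q s)
    (hl : ∀ t ∈ T, a < t → IsLeftDense T t → (∀ s ∈ T, a ≤ s → s < t → q s) → q t)
    (ha : a ∈ T) : ∀ t ∈ T, a ≤ t → q t := by
  by_contra! hcon
  set D : Set ℝ := {t | t ∈ T ∧ a ≤ t ∧ ¬ q t} with hD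
  have hne : D.Nonempty := let ⟨t, h⟩ := hcon; ⟨t, h⟩
  have hbd : BddBelow D := ⟨a, fun _ h => h.2.1⟩
  set d := sInf D with hd
  have hdT : d ∈ T := hT.closure_subset_iff.2 (fun _ h => h.1) (csInf_mem_closure hne hbd)
  have had : a ≤ d := le_csInf hne fun _ h => h.2.1
  have hlt : ∀ s ∈ T, a ≤ s → s < d → q s := by
    intro s hs has hsd
    by_contra hq
    exact absurd (csInf_le hbd ⟨hs, has, hq⟩) (not_le.2 hsd)
  -- The infimum `d` of the counterexamples is not one itself: it is `a`, or left-dense, or the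
  -- forward jump of its predecessor `m`.
  have hqd : q d := by
    rcases had.eq_or_lt with h | h
    · exact h ▸ h0
    by_cases hld : IsLeftDense T d
    · exact hl d hdT h hld hlt
    have hne' : (T ∩ Iio d).Nonempty := ⟨a, ha, h⟩
    have hbd' : BddAbove (T ∩ Iio d) := ⟨d, fun _ h => le_of_lt h.2⟩
    set m := sSup (T ∩ Iio d) with hm
    have hmT : m ∈ T := hT.closure_subset_iff.2 inter_subset_left (csSup_mem_closure hne' hbd')
    have hmd : m < d := by
      refine lt_of_le_of_ne (csSup_le hne' fun _ h => le_of_lt h.2) fun hc => hld ⟨hdT, hne', ?_⟩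
      unfold rho
      rw [if_pos hne', ← hm, hc]
    have ham : a ≤ m := le_csSup hbd' ⟨ha, h⟩
    have hs : sigma T m = d := sigma_eq_of_isLeast ⟨⟨hdT, hmd⟩, fun w hw => by
      by_contra hc
      exact absurd (le_csSup hbd' ⟨hw.1, not_le.1 hc⟩) (not_le.2 hw.2)⟩
    rw [← hs]
    exact hσ m hmT ham fun s hs has hsm => hlt s hs has (hsm.trans_lt hmd)
  have hle : ∀ s ∈ T, a ≤ s → s ≤ d → q s := fun s hs has hsd =>
    hsd.eq_or_lt.elim (fun h => h ▸ hqd) (hlt s hs has)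
  have hDgt : ∀ s ∈ D, d < s := fun s hs =>
    lt_of_le_of_ne (csInf_le hbd hs) fun h => hs.2.2 (h ▸ hqd)
  -- All counterexamples lie beyond `d`. If `σ(d) = d`, then `hr` keeps them away from `d`;
  -- otherwise none precedes `σ(d) > d`. Either way `d` is not their infimum.
  rcases (le_sigma T d).eq_or_lt with h | h
  · have := hr d hdT had h.symm hle
    rw [eventually_nhdsWithin_iff] at this
    obtain ⟨u, hu, hu'⟩ := mem_nhdsGE_iff_exists_Ico_subset.1 (this.filter_mono nhdsWithin_le_nhds)
    obtain ⟨s, hs, hsu⟩ := (csInf_lt_iff hbd hne).1 (show sInf D < u from hu)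
    exact hs.2.2 (hu' ⟨(hDgt s hs).le, hsu⟩ ⟨hs.1, hDgt s hs⟩)
  · exact absurd (le_csInf hne fun s hs => sigma_le hs.1 (hDgt s hs)) (not_le.2 h)

end Induction

/-! ### Rules for the delta derivative. -/

section Derivative

variable {T : Set ℝ} {E F : Type*} [NormedAddCommGroup E] [NormedSpace ℝ E]
  [NormedAddCommGroup F] [NormedSpace ℝ F]

theorem HasDeltaDerivAt.clm_apply {f : ℝ → E} {f' : E} {t : ℝ} (h : HasDeltaDerivAt T f f' t)
    (L : E →L[ℝ] F) : HasDeltaDerivAt T (fun s => L (f s)) (L f') t := by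
  intro ε hε
  filter_upwards [h (ε / (‖L‖ + 1)) (by positivity)] with s hs
  rw [← map_sub, ← map_smul, ← map_sub]
  refine (L.le_opNorm _).trans ?_
  calc ‖L‖ * _ ≤ (‖L‖ + 1) * (ε / (‖L‖ + 1) * |sigma T t - s|) := by gcongr; linarith
    _ = ε * |sigma T t - s| := by field_simp

theorem HasDeltaDerivAt.sub {f g : ℝ → E} {f' g' : E} {t : ℝ} (hf : HasDeltaDerivAt T f f' t)
    (hg : HasDeltaDerivAt T g g' t) :
    HasDeltaDerivAt T (fun s => f s - g s) (f' - g') t := by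
  intro ε hε
  filter_upwards [hf (ε / 2) (by positivity), hg (ε / 2) (by positivity)] with s h1 h2
  have e : f (sigma T t) - g (sigma T t) - (f s - g s) - (sigma T t - s) • (f' - g')
      = (f (sigma T t) - f s - (sigma T t - s) • f')
        - (g (sigma T t) - g s - (sigma T t - s) • g') := by module
  rw [e]
  exact (norm_sub_le _ _).trans (by linarith)

theorem HasDeltaDerivAt.mono {a b : ℝ} {f : ℝ → E} {f' : E} {t : ℝ}
    (h : HasDeltaDerivAt (T ∩ Ici a) f f' t) (hab : a ≤ b) (hbt : b ≤ t) :
    HasDeltaDerivAt (T ∩ Ici b) f f' t := by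
  intro ε hε
  have := h ε hε
  rw [sigma_inter_Ici (hab.trans hbt)] at this
  rw [sigma_inter_Ici hbt]
  exact this.filter_mono (nhdsWithin_mono _ (inter_subset_inter_right _ (Ici_subset_Ici.2 hab)))

/-- The delta derivative of a translate, if the translation commutes with the forward jump. -/
theorem HasDeltaDerivAt.comp_sub {a b : ℝ} {f : ℝ → E} {f' : E} {t : ℝ}
    (hshift : ∀ s ∈ T, a + b ≤ s → s - b ∈ T) (hbt : a + b ≤ t)
    (hσ : sigma T (t - b) = sigma T t - b)
    (h : HasDeltaDerivAt (T ∩ Ici a) f f' (t - b)) :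
    HasDeltaDerivAt (T ∩ Ici (a + b)) (fun s => f (s - b)) f' t := by
  intro ε hε
  have h1 := h ε hε
  rw [sigma_inter_Ici (by linarith), hσ] at h1
  rw [sigma_inter_Ici hbt]
  have ht : Tendsto (fun s : ℝ => s - b) (𝓝[T ∩ Ici (a + b)] t) (𝓝[T ∩ Ici a] (t - b)) := by
    refine tendsto_nhdsWithin_iff.2 ⟨?_, ?_⟩
    · exact ((continuous_id.sub continuous_const).tendsto t).mono_left nhdsWithin_le_nhds
    · filter_upwards [self_mem_nhdsWithin] with s hs
      exact ⟨hshift s hs.1 hs.2, by have := hs.2; simp only [mem_Ici] at this ⊢; linarith⟩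
  filter_upwards [ht.eventually h1] with s hs
  have e : sigma T t - b - (s - b) = sigma T t - s := by ring
  rwa [e] at hs

end Derivative

/-! ### Delta integrals under translation, and the exponential of `⊖ν`. -/

section Integral

variable {T : Set ℝ} {E : Type*} [NormedAddCommGroup E]

/-- Translation by `-b` carries a gap `[u, v)` of `T` to `[u-b, v-b)`. Since `σ(u-b) = v-b`, no
point of `T` lies inside the image, even though the translate need not exhaust `T`. -/
theorem floor_sub (hT : IsClosed T) {a b s t : ℝ} (ha : a ∈ T) (ht : t ∈ T) (has : a ≤ s)
    (hst : s ≤ t) (hshift : ∀ s ∈ T, a ≤ s → s - b ∈ T)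
    (hσ : ∀ s ∈ T, a ≤ s → sigma T (s - b) = sigma T s - b) :
    floor T (s - b) = floor T s - b := by
  by_cases hs : s ∈ T
  · rw [floor_eq_self hs, floor_eq_self (hshift s hs has)]
  · obtain ⟨u, hu, v, hv, hus, hsv, hsig, hd, hfl⟩ := exists_gap hT ha ht has hst hs
    have hau : a ≤ u := (hd a ha).resolve_right fun h => absurd (h.trans has) (not_le.2 hsv)
    rw [hfl s hus.le hsv]
    refine IsGreatest.csSup_eq ⟨⟨hshift u hu hau, by simp only [mem_Iic]; linarith⟩, ?_⟩
    rintro w ⟨hw, hws⟩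
    by_contra hc
    have h1 := sigma_le hw (not_le.1 hc)
    rw [hσ u hu hau, hsig] at h1
    have h2 : w ≤ s - b := hws
    linarith

/-- The function `floor` is monotone, hence Borel, and `f` is bounded on the compact set `T ∩ [a,
b]`. -/
theorem intervalIntegrable_comp_floor [SecondCountableTopology E] (hT : IsClosed T) {f : ℝ → E}
    {a b : ℝ} (ha : a ∈ T) (hab : a ≤ b) (hf : ContinuousOn f (T ∩ Ici a)) :
    IntervalIntegrable (fun s => f (floor T s)) volume a b := by
  borelize E
  have hspec := fun {s : ℝ} (h : a ≤ s) => floor_spec hT ha h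
  obtain ⟨B, hB⟩ := ((isCompact_Icc (a := a) (b := b)).inter_left hT).exists_bound_of_continuousOn
    (hf.mono fun s hs => ⟨hs.1, hs.2.1⟩)
  rw [intervalIntegrable_iff_integrableOn_Ioc_of_le hab]
  refine ⟨?_, .restrict_of_bounded (C := B) (by simp) ?_⟩
  · classical
    -- To the left of `a` the set defining `floor` may be empty; the truncation `max a s` avoids its
    -- default value.
    have hfl : Measurable fun s => floor T (max a s) := by
      refine Monotone.measurable fun s s' hss => ?_
      obtain ⟨h1, -, h3, -⟩ := hspec (le_max_left a s)
      exact (hspec (le_max_left a s')).2.2.2 _ h1 (h3.trans (max_le_max le_rfl hss))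
    have hm : Measurable ((T ∩ Ici a).piecewise f fun _ => 0) :=
      hf.measurable_piecewise continuousOn_const (hT.inter isClosed_Ici).measurableSet
    refine (hm.comp hfl).aestronglyMeasurable.congr ?_
    filter_upwards [ae_restrict_mem measurableSet_Ioc] with s hs
    obtain ⟨h1, h2, -, -⟩ := hspec hs.1.le
    have h3 : max a s = s := max_eq_right hs.1.le
    have h4 : floor T (max a s) ∈ T ∩ Ici a := h3.symm ▸ ⟨h1, h2⟩
    rw [Function.comp_apply, piecewise_eq_of_mem _ _ _ h4, h3]
  · refine (ae_restrict_mem measurableSet_Ioc).mono fun s hs => ?_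
    obtain ⟨h1, h2, h3, -⟩ := hspec hs.1.le
    exact hB _ ⟨h1, h2, h3.trans hs.2⟩

/-- The delta integral under a translation that commutes with the forward jump. -/
theorem deltaIntegral_comp_sub [NormedSpace ℝ E] (hT : IsClosed T) {f : ℝ → E} {a b t : ℝ} (ha : a ∈ T) (ht : t ∈ T)
    (hat : a ≤ t) (hshift : ∀ s ∈ T, a ≤ s → s - b ∈ T)
    (hσ : ∀ s ∈ T, a ≤ s → sigma T (s - b) = sigma T s - b) :
    deltaIntegral T f (a - b) (t - b) = deltaIntegral T (fun s => f (s - b)) a t := by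
  unfold deltaIntegral
  rw [← intervalIntegral.integral_comp_sub_right (fun s => f (floor T s)) b]
  refine intervalIntegral.integral_congr fun s hs => ?_
  rw [uIcc_of_le hat] at hs
  simp only [floor_sub hT ha ht hs.1 hs.2 hshift hσ]

/-- The time scale exponential of `⊖ν` decays at most as fast as the classical exponential. -/
theorem exp_neg_le_texp_ominus (T : Set ℝ) {ν t : ℝ} (hν : 0 ≤ ν) (ht : 0 ≤ t) :
    Real.exp (-(ν * t)) ≤ texp T (ominus T fun _ => ν) t 0 := by
  unfold texp deltaIntegral
  refine Real.exp_le_exp.2 ?_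
  -- For `μ > 0` the integrand is `-log(1 + μν) / μ`, and `0 ≤ log(1 + μν) ≤ μν`.
  have key : ∀ z, ‖cyl (mu T z) (ominus T (fun _ => ν) z)‖ ≤ ν := by
    intro z
    have hm := mu_nonneg T z
    unfold cyl ominus
    split_ifs with h
    · simp [h, abs_of_nonneg hν]
    · have hm' : 0 < mu T z := lt_of_le_of_ne hm (Ne.symm h)
      have hp : 0 < 1 + mu T z * ν := by positivity
      have e : 1 + -ν / (1 + mu T z * ν) * mu T z = (1 + mu T z * ν)⁻¹ := by
        field_simp; ring
      have hl : 0 ≤ Real.log (1 + mu T z * ν) :=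
        Real.log_nonneg (by nlinarith)
      have hl' := Real.log_le_sub_one_of_pos hp
      rw [e, Real.log_inv, Real.norm_eq_abs, abs_div, abs_neg, abs_of_nonneg hl, abs_of_pos hm',
        div_le_iff₀ hm']
      linarith
  -- This bound needs no integrability of the integrand.
  have := intervalIntegral.norm_integral_le_of_norm_le_const (a := 0) (b := t)
    (fun z _ => key (floor T z))
  rw [sub_zero, abs_of_nonneg ht, Real.norm_eq_abs] at this
  exact (abs_le.1 this).1

end Integral

end TimeScale

namespace CohenGrossberg

open TimeScale

/-! ### The `p`-norms and the matrix measures. -/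

section Norms

variable {p : ℝ≥0∞} [Fact (1 ≤ p)] {n : ℕ}

theorem vnorm_nonneg (v : Fin n → ℝ) : 0 ≤ vnorm p v := norm_nonneg _

theorem vnorm_add_le (v w : Fin n → ℝ) : vnorm p (v + w) ≤ vnorm p v + vnorm p w := by
  unfold vnorm
  rw [WithLp.toLp_add]
  exact norm_add_le _ _

theorem vnorm_neg (v : Fin n → ℝ) : vnorm p (-v) = vnorm p v := by
  unfold vnorm
  rw [WithLp.toLp_neg, norm_neg]

theorem vnorm_sub_le (v w : Fin n → ℝ) : vnorm p (v - w) ≤ vnorm p v + vnorm p w := by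
  rw [sub_eq_add_neg, ← vnorm_neg w]
  exact vnorm_add_le _ _

theorem vnorm_smul (r : ℝ) (v : Fin n → ℝ) : vnorm p (r • v) = |r| * vnorm p v := by
  unfold vnorm
  rw [WithLp.toLp_smul, norm_smul, Real.norm_eq_abs]

theorem mnorm_nonneg (W : Matrix (Fin n) (Fin n) ℝ) : 0 ≤ mnorm p W := norm_nonneg _

theorem vnorm_mulVec_le (W : Matrix (Fin n) (Fin n) ℝ) (v : Fin n → ℝ) :
    vnorm p (W.mulVec v) ≤ mnorm p W * vnorm p v :=
  (LinearMap.toContinuousLinearMap (Matrix.toLpLin p p W)).le_opNorm (WithLp.toLp p v)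

theorem mnorm_add_le (V W : Matrix (Fin n) (Fin n) ℝ) :
    mnorm p (V + W) ≤ mnorm p V + mnorm p W := by
  unfold mnorm
  rw [map_add, map_add]
  exact norm_add_le _ _

theorem mnorm_smul (r : ℝ) (W : Matrix (Fin n) (Fin n) ℝ) : mnorm p (r • W) = |r| * mnorm p W := by
  unfold mnorm
  rw [map_smul, map_smul, norm_smul, Real.norm_eq_abs]

theorem mnorm_one_le : mnorm p (1 : Matrix (Fin n) (Fin n) ℝ) ≤ 1 := by
  unfold mnorm
  rw [Matrix.toLpLin_one]
  exact ContinuousLinearMap.norm_id_le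

theorem mnorm_one [Nonempty (Fin n)] : mnorm p (1 : Matrix (Fin n) (Fin n) ℝ) = 1 := by
  unfold mnorm
  rw [Matrix.toLpLin_one]
  exact ContinuousLinearMap.norm_id

/-- The vector `p`-norm as the norm of a continuous linear image. -/
theorem vnorm_eq_norm_equiv (v : Fin n → ℝ) :
    vnorm p v = ‖(PiLp.continuousLinearEquiv p ℝ fun _ : Fin n => ℝ).symm v‖ := rfl

/-- Delta derivatives are formed in `Fin n → ℝ` with its sup norm; the equivalence of norms
transfers remainder estimates and bounds to the `p`-norm. -/
theorem exists_vnorm_le (p : ℝ≥0∞) [Fact (1 ≤ p)] (n : ℕ) :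
    ∃ D, 0 ≤ D ∧ ∀ v : Fin n → ℝ, vnorm p v ≤ D * ‖v‖ :=
  let L := (PiLp.continuousLinearEquiv p ℝ fun _ : Fin n => ℝ).symm.toContinuousLinearMap
  ⟨‖L‖, norm_nonneg _, fun v => L.le_opNorm v⟩

theorem exists_norm_le_vnorm (p : ℝ≥0∞) [Fact (1 ≤ p)] (n : ℕ) :
    ∃ D, 0 ≤ D ∧ ∀ v : Fin n → ℝ, ‖v‖ ≤ D * vnorm p v :=
  let L := (PiLp.continuousLinearEquiv p ℝ fun _ : Fin n => ℝ).toContinuousLinearMap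
  ⟨‖L‖, norm_nonneg _, fun v => L.le_opNorm (WithLp.toLp p v)⟩

/-- The integral commutes with the linear equivalence onto the space normed by the `p`-norm, so no
equivalence constant is lost. -/
theorem vnorm_integral_le {f : ℝ → Fin n → ℝ} {a b B : ℝ} (hab : a ≤ b)
    (h : ∀ s ∈ Ioc a b, vnorm p (f s) ≤ B) : vnorm p (∫ s in a..b, f s) ≤ B * (b - a) := by
  rw [vnorm_eq_norm_equiv, intervalIntegral.integral_of_le hab,
    ← ContinuousLinearEquiv.integral_comp_comm, ← intervalIntegral.integral_of_le hab]
  have := intervalIntegral.norm_integral_le_of_norm_le_const (a := a) (b := b)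
    (f := fun s => (PiLp.continuousLinearEquiv p ℝ fun _ : Fin n => ℝ).symm (f s)) (C := B)
    (fun s hs => h s (by rwa [uIoc_of_le hab] at hs))
  rwa [abs_of_nonneg (sub_nonneg.2 hab)] at this

theorem genMeasure_le (W : Matrix (Fin n) (Fin n) ℝ) {h : ℝ} (hh : 0 < h) :
    genMeasure p W h ≤ mnorm p W := by
  unfold genMeasure
  rw [div_le_iff₀ hh]
  have h1 := mnorm_add_le (p := p) 1 (h • W)
  rw [mnorm_smul, abs_of_pos hh] at h1
  linarith [mnorm_one_le (p := p) (n := n)]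

theorem neg_mnorm_le_genMeasure [Nonempty (Fin n)] (W : Matrix (Fin n) (Fin n) ℝ) {h : ℝ}
    (hh : 0 < h) : -mnorm p W ≤ genMeasure p W h := by
  unfold genMeasure
  rw [le_div_iff₀ hh]
  have h1 := mnorm_add_le (p := p) (1 + h • W) (-h • W)
  rw [mnorm_smul, abs_neg, abs_of_pos hh, add_assoc, neg_smul, add_neg_cancel, add_zero,
    mnorm_one] at h1
  linarith

/-- Convexity of the norm: for `h ≤ k`, `1 + h W` is a convex combination of `1` and `1 + k W`. -/
theorem monotoneOn_genMeasure (W : Matrix (Fin n) (Fin n) ℝ) :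
    MonotoneOn (genMeasure p W) (Ioi 0) := by
  intro h hh k hk hhk
  simp only [mem_Ioi] at hh hk
  unfold genMeasure
  rw [div_le_div_iff₀ hh hk]
  have e : k • (1 + h • W) = (k - h) • (1 : Matrix (Fin n) (Fin n) ℝ) + h • (1 + k • W) := by
    module
  have h1 := mnorm_add_le (p := p) ((k - h) • (1 : Matrix (Fin n) (Fin n) ℝ)) (h • (1 + k • W))
  rw [← e, mnorm_smul, mnorm_smul, mnorm_smul, abs_of_pos hh, abs_of_pos hk,
    abs_of_nonneg (sub_nonneg.2 hhk)] at h1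
  nlinarith [mnorm_one_le (p := p) (n := n)]

/-- A monotone function bounded below by `-‖W‖` has a limit at `0+`, so the `limUnder` in `logNorm`
is not a default value. The lower bound uses `‖1‖ = 1`, hence `n > 0`. -/
theorem tendsto_genMeasure_logNorm [Nonempty (Fin n)] (W : Matrix (Fin n) (Fin n) ℝ) :
    Tendsto (genMeasure p W) (𝓝[>] 0) (𝓝 (logNorm p W)) := by
  refine tendsto_nhds_limUnder ⟨_, (monotoneOn_genMeasure W).tendsto_nhdsGT ?_⟩
  refine ⟨-mnorm p W, ?_⟩
  rintro _ ⟨h, hh, rfl⟩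
  exact neg_mnorm_le_genMeasure W hh

/-- Ensures that the `sSup` in `unifiedMeasure` is a genuine supremum. -/
theorem bddAbove_unifiedMeasure (W : Matrix (Fin n) (Fin n) ℝ) (T : Set ℝ) :
    BddAbove ({r | ∃ t ∈ T, 0 < mu T t ∧ r = genMeasure p W (mu T t)} ∪
      {r | (∃ t ∈ T, mu T t = 0) ∧ r = logNorm p W}) := by
  refine BddAbove.union ⟨mnorm p W, ?_⟩ ⟨logNorm p W, ?_⟩
  · rintro _ ⟨t, -, ht, rfl⟩
    exact genMeasure_le W ht
  · rintro _ ⟨-, rfl⟩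
    exact le_rfl

theorem genMeasure_le_unifiedMeasure (W : Matrix (Fin n) (Fin n) ℝ) {T : Set ℝ} {t : ℝ}
    (ht : t ∈ T) (hm : 0 < mu T t) : genMeasure p W (mu T t) ≤ unifiedMeasure p W T :=
  le_csSup (bddAbove_unifiedMeasure W T) (Or.inl ⟨t, ht, hm, rfl⟩)

theorem logNorm_le_unifiedMeasure (W : Matrix (Fin n) (Fin n) ℝ) {T : Set ℝ} {t : ℝ}
    (ht : t ∈ T) (hm : mu T t = 0) : logNorm p W ≤ unifiedMeasure p W T :=
  le_csSup (bddAbove_unifiedMeasure W T) (Or.inr ⟨⟨t, ht, hm⟩, rfl⟩)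

end Norms

end CohenGrossberg

/-! ### The Halanay inequality. -/

namespace TimeScale

/-- A Halanay inequality on time scales. -/
theorem halanay {T : Set ℝ} (hT : IsClosed T) {t₁ : ℝ} (ht₁ : t₁ ∈ T) {V : ℝ → ℝ}
    {m₁ m₂ τ ν C : ℝ} (hV : ContinuousOn V (T ∩ Ici t₁)) (hC : 0 < C) (hτ : 0 ≤ τ) (hν₀ : 0 ≤ ν)
    (hν : m₂ * Real.exp (ν * τ) + ν < m₁)
    (hreg : ∀ t ∈ T, 0 < 1 - mu T t * m₁)
    (hinit : ∀ s ∈ T, t₁ - τ ≤ s → s ≤ t₁ → V s ≤ C * Real.exp (-(ν * s)))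
    (hjump : ∀ t ∈ T, t₁ ≤ t → ∀ S, (∀ s ∈ T, t - τ ≤ s → s ≤ t → V s ≤ S) →
      V (sigma T t) ≤ (1 - mu T t * m₁) * V t + mu T t * (m₂ * S))
    (hdense : ∀ t ∈ T, t₁ ≤ t → sigma T t = t → ∀ S, (∀ s ∈ T, t - τ ≤ s → s ≤ t → V s ≤ S) →
      ∀ ε > 0, ∀ᶠ s in 𝓝[T ∩ Ioi t] t,
        V s ≤ (1 - (s - t) * m₁) * V t + (s - t) * (m₂ * S + ε)) :
    ∀ t ∈ T, t₁ ≤ t → V t ≤ C * Real.exp (-(ν * t)) := by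
  -- On the window `s ≥ t - τ`, so `e^{-νs} ≤ e^{-νt} e^{ντ}`.
  have hhist : ∀ t, t₁ ≤ t → (∀ s ∈ T, t₁ ≤ s → s ≤ t → V s ≤ C * Real.exp (-(ν * s))) →
      ∀ s ∈ T, t - τ ≤ s → s ≤ t → V s ≤ C * Real.exp (-(ν * t)) * Real.exp (ν * τ) := by
    intro t htt h s hs hs1 hs2
    have h1 : V s ≤ C * Real.exp (-(ν * s)) := by
      rcases le_total t₁ s with h' | h'
      · exact h s hs h' hs2
      · exact hinit s hs (by linarith) h'
    refine h1.trans ?_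
    rw [mul_assoc, ← Real.exp_add]
    gcongr
    nlinarith
  -- One step of length `s - t`. The slack `m₁ - (m₂ e^{ντ} + ν)` is chosen so that replacing `V t`
  -- by `w` turns the left side into exactly `(1 - ν(s-t)) w`. The slack is discarded at jumps and
  -- serves as `ε` at right-dense points.
  have hnum : ∀ t s, t ≤ s → 0 ≤ 1 - (s - t) * m₁ → V t ≤ C * Real.exp (-(ν * t)) →
      (1 - (s - t) * m₁) * V t + (s - t) * (m₂ * (C * Real.exp (-(ν * t)) * Real.exp (ν * τ)) +
        (m₁ - (m₂ * Real.exp (ν * τ) + ν)) * (C * Real.exp (-(ν * t)))) ≤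
      C * Real.exp (-(ν * s)) := by
    intro t s hts hp hVt
    set w := C * Real.exp (-(ν * t)) with hw
    have hwp : 0 < w := by positivity
    have h1 : C * Real.exp (-(ν * s)) = w * Real.exp (-(ν * (s - t))) := by
      rw [hw, mul_assoc, ← Real.exp_add]; ring_nf
    have h2 := Real.add_one_le_exp (-(ν * (s - t)))
    have h3 := mul_le_mul_of_nonneg_left hVt hp
    have h4 := mul_le_mul_of_nonneg_left h2 hwp.le
    rw [h1]
    linarith
  refine scale_induction hT (hinit t₁ ht₁ (by linarith) le_rfl) ?_ ?_ ?_ ht₁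
  · intro t ht htt h
    refine (hjump t ht htt _ (hhist t htt h)).trans
      (le_trans ?_ (hnum t (sigma T t) (le_sigma T t) (hreg t ht).le (h t ht htt le_rfl)))
    have hm := mu_nonneg T t
    have : 0 ≤ (m₁ - (m₂ * Real.exp (ν * τ) + ν)) * (C * Real.exp (-(ν * t))) :=
      mul_nonneg (by linarith) (by positivity)
    change _ ≤ (1 - mu T t * m₁) * V t + mu T t * (_ + _)
    gcongr
    linarith
  · intro t ht htt hσ h
    have hε : 0 < (m₁ - (m₂ * Real.exp (ν * τ) + ν)) * (C * Real.exp (-(ν * t))) :=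
      mul_pos (by linarith) (by positivity)
    have hsm : ∀ᶠ s in 𝓝[T ∩ Ioi t] t, 0 < 1 - (s - t) * m₁ := by
      have hc : Continuous fun s : ℝ => 1 - (s - t) * m₁ := by fun_prop
      exact ((hc.tendsto t).mono_left nhdsWithin_le_nhds).eventually_const_lt (by simp)
    filter_upwards [hdense t ht htt hσ _ (hhist t htt h) _ hε, hsm, self_mem_nhdsWithin]
      with s hs hs' hs''
    exact hs.trans (hnum t s (le_of_lt hs''.2) hs'.le (h t ht htt le_rfl))
  -- At a left-dense point the bound passes to the limit from the left by continuity.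
  · intro t ht htt hld h
    have := hld.neBot
    have hev : ∀ᶠ s in 𝓝[T ∩ Iio t] t, s ∈ T ∩ Iio t ∧ t₁ < s :=
      eventually_mem_nhdsWithin.and (mem_nhdsWithin_of_mem_nhds (Ioi_mem_nhds htt))
    have hc : Tendsto V (𝓝[T ∩ Iio t] t) (𝓝 (V t)) := by
      refine (hV t ⟨ht, htt.le⟩).tendsto.mono_left (nhdsWithin_le_of_mem ?_)
      filter_upwards [hev] with s hs
      exact ⟨hs.1.1, hs.2.le⟩
    have hc' : Continuous fun s : ℝ => C * Real.exp (-(ν * s)) := by fun_prop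
    refine le_of_tendsto_of_tendsto hc ((hc'.tendsto t).mono_left nhdsWithin_le_nhds) ?_
    filter_upwards [hev] with s hs
    exact h s hs.1.1 hs.2.le hs.1.2

end TimeScale

namespace CohenGrossberg

open TimeScale

/-! ### Growth of the norm along a linear equation with forcing. -/

section Growth

variable {p : ℝ≥0∞} [Fact (1 ≤ p)] {n : ℕ}

/-- The Euler step is `(1 + h W) v + h g`, and `1 + h ω(W, h)` is by definition the norm of `1 + h
W`. -/
theorem vnorm_euler_le (W : Matrix (Fin n) (Fin n) ℝ) (v g : Fin n → ℝ) {h : ℝ} (hh : 0 < h) :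
    vnorm p (v + h • (W.mulVec v + g)) ≤
      (1 + h * genMeasure p W h) * vnorm p v + h * vnorm p g := by
  have e : v + h • (W.mulVec v + g) = (1 + h • W).mulVec v + h • g := by
    rw [Matrix.add_mulVec, Matrix.one_mulVec, Matrix.smul_mulVec, smul_add, add_assoc]
  have e' : 1 + h * genMeasure p W h = mnorm p (1 + h • W) := by
    unfold genMeasure
    field_simp
    ring
  rw [e, e']
  refine (vnorm_add_le _ _).trans ?_
  rw [vnorm_smul, abs_of_pos hh]
  gcongr
  exact vnorm_mulVec_le _ _

variable {T : Set ℝ} {a t : ℝ} {v : ℝ → Fin n → ℝ} {g : Fin n → ℝ} {W : Matrix (Fin n) (Fin n) ℝ}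

theorem vnorm_sigma_le (ht : t ∈ T) (hat : a ≤ t)
    (hv : HasDeltaDerivAt (T ∩ Ici a) v (W.mulVec (v t) + g) t) :
    vnorm p (v (sigma T t)) ≤
      (1 + mu T t * unifiedMeasure p W T) * vnorm p (v t) + mu T t * vnorm p g := by
  rcases (mu_nonneg T t).eq_or_lt with h | h
  · have : sigma T t = t := by unfold mu at h; linarith
    rw [← h, this]; simp
  · have h1 := hv.sigma_eq ⟨ht, hat⟩
    rw [sigma_inter_Ici hat] at h1
    rw [h1]
    refine (vnorm_euler_le W _ g h).trans ?_
    gcongr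
    · exact vnorm_nonneg _
    · exact genMeasure_le_unifiedMeasure W ht h

/-- Near a right-dense point `v s` is an Euler step plus `o(s - t)`, and `ω(W, s-t)` comes
arbitrarily close to `Λ(W)`. Each of the two errors takes half of `ε`. -/
theorem eventually_vnorm_le [Nonempty (Fin n)] (ht : t ∈ T) (hat : a ≤ t) (hσ : sigma T t = t)
    (hv : HasDeltaDerivAt (T ∩ Ici a) v (W.mulVec (v t) + g) t) {ε : ℝ} (hε : 0 < ε) :
    ∀ᶠ s in 𝓝[T ∩ Ioi t] t, vnorm p (v s) ≤
      (1 + (s - t) * unifiedMeasure p W T) * vnorm p (v t) + (s - t) * (vnorm p g + ε) := by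
  obtain ⟨D, hD, hDv⟩ := exists_vnorm_le p n
  have hm : mu T t = 0 := by unfold mu; linarith
  have hV := vnorm_nonneg (p := p) (v t)
  -- `D` compares the sup norm with the `p`-norm; the `1` keeps the denominator positive.
  have h1 := (hv (ε / 2 / (D + 1)) (by positivity)).filter_mono
    (nhdsWithin_mono t (show T ∩ Ioi t ⊆ T ∩ Ici a from fun s hs => ⟨hs.1, hat.trans (le_of_lt hs.2)⟩))
  rw [sigma_inter_Ici hat, hσ] at h1
  have h2 : ∀ᶠ h in 𝓝[>] (0 : ℝ),
      genMeasure p W h < unifiedMeasure p W T + ε / 2 / (vnorm p (v t) + 1) :=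
    (tendsto_genMeasure_logNorm W).eventually_lt_const
      ((logNorm_le_unifiedMeasure W ht hm).trans_lt (lt_add_of_pos_right _ (by positivity)))
  have h3 : Tendsto (fun s : ℝ => s - t) (𝓝[T ∩ Ioi t] t) (𝓝[>] 0) := by
    refine tendsto_nhdsWithin_iff.2 ⟨?_, ?_⟩
    · have hc : Continuous fun s : ℝ => s - t := by fun_prop
      simpa using (hc.tendsto t).mono_left nhdsWithin_le_nhds
    · filter_upwards [self_mem_nhdsWithin] with s hs
      exact sub_pos.2 (mem_Ioi.1 hs.2)
  filter_upwards [h1, h3.eventually h2, self_mem_nhdsWithin] with s hs1 hs2 hs3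
  have hst : 0 < s - t := sub_pos.2 (mem_Ioi.1 hs3.2)
  have e : v s = v t + (s - t) • (W.mulVec (v t) + g)
      - (v t - v s - (t - s) • (W.mulVec (v t) + g)) := by module
  have h4 : vnorm p (v t - v s - (t - s) • (W.mulVec (v t) + g)) ≤ (s - t) * (ε / 2) := by
    refine (hDv _).trans ?_
    rw [abs_sub_comm, abs_of_pos hst] at hs1
    calc D * _ ≤ (D + 1) * (ε / 2 / (D + 1) * (s - t)) := by gcongr; linarith
      _ = (s - t) * (ε / 2) := by field_simp
  have h5 : ε / 2 / (vnorm p (v t) + 1) * vnorm p (v t) ≤ ε / 2 := by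
    rw [div_mul_eq_mul_div, div_le_iff₀ (by positivity)]
    nlinarith
  have h6 := vnorm_euler_le (p := p) W (v t) g hst
  have h7 : genMeasure p W (s - t) * vnorm p (v t) ≤
      (unifiedMeasure p W T + ε / 2 / (vnorm p (v t) + 1)) * vnorm p (v t) := by gcongr
  have h8 : genMeasure p W (s - t) * vnorm p (v t) ≤
      unifiedMeasure p W T * vnorm p (v t) + ε / 2 := by linarith
  have h9 := mul_le_mul_of_nonneg_left h8 hst.le
  rw [e]
  refine (vnorm_sub_le _ _).trans ?_
  linarith

end Growth

/-! ### Lipschitz estimates for the right-hand sides. -/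

section Field

variable {p : ℝ≥0∞} [Fact (1 ≤ p)] {n : ℕ}

/-- The Lipschitz estimate for the right-hand sides of the two networks. -/
theorem Consts.Admissible.vnorm_rhs_sub_le {N : Network n} {c : Consts} (hc : c.Admissible p N)
    (x y x' y' X Y : Fin n → ℝ) {S r : ℝ} (hE : vnorm p (y - x) ≤ S) (hE' : vnorm p (y' - x') ≤ S)
    (hX : vnorm p X ≤ c.MF * r) (hXY : vnorm p (Y - X) ≤ c.LF * S * r) :
    vnorm p (-(N.Gam y).mulVec (N.beh y - N.P.mulVec (N.act y) - N.Q.mulVec (N.act y')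
        - N.R.mulVec Y - N.bias)
      - -(N.Gam x).mulVec (N.beh x - N.P.mulVec (N.act x) - N.Q.mulVec (N.act x')
        - N.R.mulVec X - N.bias)) ≤
      ((c.MΓ * c.LΥ + c.MΥ * c.LΓ) + (c.MΓ * c.LF + c.MF * c.LΓ) * mnorm p N.P
        + c.LΓ * vnorm p N.bias) * vnorm p (y - x)
      + (c.MΓ * c.LF + c.MF * c.LΓ) * (mnorm p N.Q + r * mnorm p N.R) * S := by
  have hLΓ := hc.LΓ_pos
  have hLΥ := hc.LΥ_pos
  have hLF := hc.LF_pos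
  have hMΓ := hc.MΓ_pos
  have hMΥ := hc.MΥ_pos
  have hMF := hc.MF_pos
  have hP := mnorm_nonneg (p := p) N.P
  have hQ := mnorm_nonneg (p := p) N.Q
  have hR := mnorm_nonneg (p := p) N.R
  have hI := vnorm_nonneg (p := p) N.bias
  have hE0 := vnorm_nonneg (p := p) (y - x)
  have hr : 0 ≤ r := nonneg_of_mul_nonneg_right ((vnorm_nonneg X).trans hX) hMF
  set A := N.beh y - N.P.mulVec (N.act y) - N.Q.mulVec (N.act y') - N.R.mulVec Y - N.bias with hA
  set B := N.beh x - N.P.mulVec (N.act x) - N.Q.mulVec (N.act x') - N.R.mulVec X - N.bias with hB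
  set E := vnorm p (y - x) with hEdef
  -- The splitting `Γ(y)A - Γ(x)B = Γ(y)(A - B) + (Γ(y) - Γ(x))B` produces the two kinds of
  -- products: `MΓ` with Lipschitz constants, and `LΓ` with bounds.
  have e1 : -(N.Gam y).mulVec A - -(N.Gam x).mulVec B
      = -((N.Gam y).mulVec (A - B) + (N.Gam y - N.Gam x).mulVec B) := by
    rw [Matrix.mulVec_sub _ A B, Matrix.sub_mulVec]
    clear_value A B
    abel
  have e2 : A - B = N.beh y - N.beh x - N.P.mulVec (N.act y - N.act x)
      - N.Q.mulVec (N.act y' - N.act x') - N.R.mulVec (Y - X) := by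
    simp only [hA, hB, Matrix.mulVec_sub]; abel
  have hmv : ∀ (W : Matrix (Fin n) (Fin n) ℝ) (v : Fin n → ℝ) {q : ℝ}, vnorm p v ≤ q →
      vnorm p (W.mulVec v) ≤ mnorm p W * q := fun W v q hv =>
    (vnorm_mulVec_le W v).trans (mul_le_mul_of_nonneg_left hv (mnorm_nonneg W))
  have hAB : vnorm p (A - B) ≤ c.LΥ * E + mnorm p N.P * (c.LF * E) + mnorm p N.Q * (c.LF * S)
      + mnorm p N.R * (c.LF * S * r) := by
    rw [e2]
    have h1 := hc.lip_beh y x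
    have h2 := hmv N.P _ (hc.lip_act y x)
    have h3 := hmv N.Q _ ((hc.lip_act y' x').trans (mul_le_mul_of_nonneg_left hE' hLF.le))
    have h4 := hmv N.R _ hXY
    refine (vnorm_sub_le _ _).trans (add_le_add ?_ h4)
    refine (vnorm_sub_le _ _).trans (add_le_add ?_ h3)
    exact (vnorm_sub_le _ _).trans (add_le_add h1 h2)
  have hBB : vnorm p B ≤ c.MΥ + mnorm p N.P * c.MF + mnorm p N.Q * c.MF
      + mnorm p N.R * (c.MF * r) + vnorm p N.bias := by
    refine (vnorm_sub_le _ _).trans (add_le_add ?_ le_rfl)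
    refine (vnorm_sub_le _ _).trans (add_le_add ?_ (hmv _ _ hX))
    refine (vnorm_sub_le _ _).trans (add_le_add ?_ (hmv _ _ (hc.bdd_act _)))
    exact (vnorm_sub_le _ _).trans (add_le_add (hc.bdd_beh _) (hmv _ _ (hc.bdd_act _)))
  have h1 : vnorm p ((N.Gam y).mulVec (A - B)) ≤ c.MΓ * (c.LΥ * E + mnorm p N.P * (c.LF * E)
      + mnorm p N.Q * (c.LF * S) + mnorm p N.R * (c.LF * S * r)) :=
    (vnorm_mulVec_le _ _).trans (mul_le_mul (hc.bdd_amp y) hAB (vnorm_nonneg _) hMΓ.le)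
  have h2 : vnorm p ((N.Gam y - N.Gam x).mulVec B) ≤ c.LΓ * E * (c.MΥ + mnorm p N.P * c.MF
      + mnorm p N.Q * c.MF + mnorm p N.R * (c.MF * r) + vnorm p N.bias) :=
    (vnorm_mulVec_le _ _).trans
      (mul_le_mul (hc.lip_amp y x) hBB (vnorm_nonneg _) (mul_nonneg hLΓ.le hE0))
  -- The delayed terms of `B`, multiplied by `LΓ E`, involve only the current error `E`; since `E ≤
  -- S`, they are counted with the history term, as in `M₂`.
  have h3 : c.MF * c.LΓ * (mnorm p N.Q + r * mnorm p N.R) * E ≤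
      c.MF * c.LΓ * (mnorm p N.Q + r * mnorm p N.R) * S := by gcongr
  rw [e1, vnorm_neg]
  refine (vnorm_add_le _ _).trans ?_
  linarith

theorem Consts.Admissible.continuous_act {N : Network n} {c : Consts} (hc : c.Admissible p N) :
    Continuous N.act := by
  obtain ⟨D, hD, hDv⟩ := exists_vnorm_le p n
  obtain ⟨D', hD', hDv'⟩ := exists_norm_le_vnorm p n
  refine (LipschitzWith.of_dist_le_mul (K := ⟨D' * (c.LF * D), ?_⟩) fun x y => ?_).continuous
  · exact mul_nonneg hD' (mul_nonneg hc.LF_pos.le hD)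
  · rw [dist_eq_norm, dist_eq_norm]
    calc ‖N.act x - N.act y‖ ≤ D' * (c.LF * (D * ‖x - y‖)) :=
          (hDv' _).trans (mul_le_mul_of_nonneg_left ((hc.lip_act x y).trans
            (mul_le_mul_of_nonneg_left (hDv _) hc.LF_pos.le)) hD')
      _ = D' * (c.LF * D) * ‖x - y‖ := by ring

end Field

end CohenGrossberg

/-! ### The synchronization error of the two networks. -/

namespace CohenGrossberg

open TimeScale

variable {p : ℝ≥0∞} [Fact (1 ≤ p)] {n : ℕ} {N : Network n} {T : Set ℝ} {β : ℝ}
  {K : Matrix (Fin n) (Fin n) ℝ} {φ ψ x y : ℝ → Fin n → ℝ}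

namespace Network

theorem IsDrive.continuousOn (hx : N.IsDrive T β φ x) : ContinuousOn x (T ∩ Ici 0) :=
  fun t ht => (hx.eqn t ht.1 ht.2).continuousWithinAt ht

theorem IsResponse.continuousOn (hy : N.IsResponse T β K x ψ y) : ContinuousOn y (T ∩ Ici 0) :=
  fun t ht => (hy.eqn t ht.1 ht.2).continuousWithinAt ht

/-- The synchronization error is bounded on compact intervals. -/
theorem exists_vnorm_error_le (p : ℝ≥0∞) [Fact (1 ≤ p)] (hT : IsClosed T) (hβ : 0 ≤ β)
    (hτ : 0 ≤ N.τ) (hTβ : ∀ t ∈ T, 0 ≤ t → t - β ∈ T)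
    (hφ : RdContinuous (T ∩ Icc (-N.τ) 0) φ) (hx : N.IsDrive T β φ x)
    (hy : N.IsResponse T β K x ψ y) (b : ℝ) :
    ∃ B, 0 ≤ B ∧ ∀ t ∈ T, 0 ≤ t → t ≤ b → vnorm p (y t - x (t - β)) ≤ B := by
  obtain ⟨D, hD, hDv⟩ := exists_vnorm_le p n
  have hK : IsCompact (T ∩ Icc 0 b) := isCompact_Icc.inter_left hT
  have hsub : T ∩ Icc 0 b ⊆ T ∩ Ici 0 := fun s hs => ⟨hs.1, hs.2.1⟩
  obtain ⟨By, hBy⟩ := hK.exists_bound_of_continuousOn (hy.continuousOn.mono hsub)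
  obtain ⟨Bx, hBx⟩ := hK.exists_bound_of_continuousOn (hx.continuousOn.mono hsub)
  obtain ⟨Bφ, hBφ⟩ := hφ.bounded (hT.inter isClosed_Icc) (-N.τ) 0
  have hxb : ∀ t ∈ T, 0 ≤ t → t ≤ b → ‖x (t - β)‖ ≤ max (max Bx Bφ) ‖φ (-N.τ)‖ := by
    intro t ht h0 htb
    have hm := hTβ t ht h0
    -- The delayed drive state is a value of the solution, of the initial function, or of the
    -- constant continuation.
    rcases le_total 0 (t - β) with h | h
    · exact (hBx _ ⟨hm, h, by linarith⟩).trans ((le_max_left _ _).trans (le_max_left _ _))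
    rcases le_total (-N.τ) (t - β) with h' | h'
    · rw [hx.init _ hm h' h]
      exact (hBφ _ ⟨⟨hm, h', h⟩, h', h⟩).trans ((le_max_right _ _).trans (le_max_left _ _))
    · rw [hx.past _ hm (by linarith) h']
      exact le_max_right _ _
  refine ⟨D * (max By 0 + max (max Bx Bφ) ‖φ (-N.τ)‖), ?_, fun t ht h0 htb => ?_⟩
  · have := (norm_nonneg (φ (-N.τ))).trans (le_max_right (max Bx Bφ) _)
    have := le_max_right By 0
    positivity
  · refine (hDv _).trans (mul_le_mul_of_nonneg_left ((norm_sub_le _ _).trans ?_) hD)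
    exact add_le_add ((hBy t ⟨ht, h0, htb⟩).trans (le_max_left _ _)) (hxb t ht h0 htb)

/-- The dynamics of the synchronization error. -/
theorem hasDeltaDerivAt_error (hTβ : ∀ t ∈ T, 0 ≤ t → t - β ∈ T) (hβ : 0 ≤ β)
    (hσβ : ∀ t ∈ T, β ≤ t → sigma T (t - β) = sigma T t - β)
    (hx : N.IsDrive T β φ x) (hy : N.IsResponse T β K x ψ y) {t : ℝ} (ht : t ∈ T) (hβt : β ≤ t) :
    HasDeltaDerivAt (T ∩ Ici β) (fun s => y s - x (s - β))
      (N.field T y t - K.mulVec (y t - x (t - β)) - N.field T x (t - β)) t := by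
  have h1 := (hy.eqn t ht (hβ.trans hβt)).mono hβ hβt
  have h2 := HasDeltaDerivAt.comp_sub (a := 0) (b := β) (fun s hs h => hTβ s hs (by linarith))
    (by linarith) (hσβ t ht hβt) (hx.eqn (t - β) (hTβ t ht (hβ.trans hβt)) (by linarith))
  rw [zero_add] at h2
  exact h1.sub h2

/-- The Lipschitz estimate for the difference of the two fields, in terms of the history of the
synchronization error. -/
theorem vnorm_field_sub_le {c : Consts} (hc : c.Admissible p N) (hT : IsClosed T) (hβ : 0 ≤ β)
    (hτ₁ : 0 < N.τ₁) (hτ₂ : 0 < N.τ₂)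
    (hT₁ : ∀ t ∈ T, 0 ≤ t → t - N.τ₁ ∈ T) (hT₂ : ∀ t ∈ T, 0 ≤ t → t - N.τ₂ ∈ T)
    (hTβ : ∀ t ∈ T, 0 ≤ t → t - β ∈ T)
    (hσβ : ∀ t ∈ T, β ≤ t → sigma T (t - β) = sigma T t - β)
    (hx : N.IsDrive T β φ x) (hy : N.IsResponse T β K x ψ y) {t : ℝ} (ht : t ∈ T)
    (hβt : β + N.τ ≤ t) {S : ℝ}
    (hS : ∀ s ∈ T, t - N.τ ≤ s → s ≤ t → vnorm p (y s - x (s - β)) ≤ S) :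
    vnorm p (N.field T y t - N.field T x (t - β)) ≤
      ((c.MΓ * c.LΥ + c.MΥ * c.LΓ) + (c.MΓ * c.LF + c.MF * c.LΓ) * mnorm p N.P
        + c.LΓ * vnorm p N.bias) * vnorm p (y t - x (t - β))
      + (c.MΓ * c.LF + c.MF * c.LΓ) * (mnorm p N.Q + N.τ * mnorm p N.R) * S := by
  have h1τ : N.τ₁ ≤ N.τ := le_max_left _ _
  have h2τ : N.τ₂ ≤ N.τ := le_max_right _ _
  have ht0 : 0 ≤ t := by linarith
  have haT := hT₂ t ht ht0
  have hat : t - N.τ₂ ≤ t := by linarith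
  have hshift : ∀ s ∈ T, t - N.τ₂ ≤ s → s - β ∈ T := fun s hs h => hTβ s hs (by linarith)
  have hsig : ∀ s ∈ T, t - N.τ₂ ≤ s → sigma T (s - β) = sigma T s - β :=
    fun s hs h => hσβ s hs (by linarith)
  have hact := hc.continuous_act
  have hfl : ∀ s ∈ Ioc (t - N.τ₂) t,
      floor T s ∈ T ∧ t - N.τ₂ ≤ floor T s ∧ floor T s ≤ t := fun s hs =>
    let ⟨h1, h2, h3, _⟩ := floor_spec hT haT hs.1.le
    ⟨h1, h2, h3.trans hs.2⟩
  have hiy : IntervalIntegrable (fun s => N.act (y (floor T s))) volume (t - N.τ₂) t :=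
    intervalIntegrable_comp_floor hT (f := fun s => N.act (y s)) haT hat
      (hact.comp_continuousOn (hy.continuousOn.mono
        (inter_subset_inter_right _ (Ici_subset_Ici.2 (by linarith)))))
  have hix : IntervalIntegrable (fun s => N.act (x (floor T s - β))) volume (t - N.τ₂) t := by
    refine intervalIntegrable_comp_floor hT (f := fun s => N.act (x (s - β))) haT hat
      (hact.comp_continuousOn (hx.continuousOn.comp (by fun_prop) fun s hs => ?_))
    have hs2 : t - N.τ₂ ≤ s := hs.2
    exact ⟨hshift s hs.1 hs.2, by simp only [mem_Ici]; linarith⟩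
  -- The drive's integral is moved to `[t-τ₂, t]`, so that both distributed delays can be subtracted
  -- under one integral. Commuting with `σ` from time `β` on suffices, as `t - τ₂ ≥ β`.
  have hshiftI : deltaIntegral T (fun s => N.act (x s)) (t - β - N.τ₂) (t - β)
      = deltaIntegral T (fun s => N.act (x (s - β))) (t - N.τ₂) t := by
    rw [sub_right_comm]
    exact deltaIntegral_comp_sub hT haT ht hat hshift hsig
  unfold field
  rw [hshiftI, sub_right_comm t β]
  have hS0 : 0 ≤ S := (vnorm_nonneg _).trans (hS t ht (by linarith) le_rfl)
  -- Here `r = τ`: the integrals extend over an interval of length `τ₂ ≤ τ`.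
  refine hc.vnorm_rhs_sub_le _ _ _ _ _ _ (hS t ht (by linarith) le_rfl)
    (hS _ (hT₁ t ht ht0) (by linarith) (by linarith)) ?_ ?_
  · refine (vnorm_integral_le hat fun s _ => hc.bdd_act _).trans ?_
    exact mul_le_mul_of_nonneg_left (by linarith) hc.MF_pos.le
  · unfold deltaIntegral
    rw [← intervalIntegral.integral_sub hiy hix]
    refine (vnorm_integral_le (B := c.LF * S) hat fun s hs => ?_).trans ?_
    · obtain ⟨h1, h2, h3⟩ := hfl s hs
      exact (hc.lip_act _ _).trans
        (mul_le_mul_of_nonneg_left (hS _ h1 (by linarith) h3) hc.LF_pos.le)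
    · exact mul_le_mul_of_nonneg_left (by linarith) (mul_nonneg hc.LF_pos.le hS0)

end Network

end CohenGrossberg

/-! ### Exponential lag synchronization. -/

theorem mainTheorem1 {n : ℕ}
    -- the time scale, containing the initial time
    (T : Set ℝ) (hT : IsClosed T) (h0 : (0 : ℝ) ∈ T)
    -- the networks and their delays
    (N : CohenGrossberg.Network n) (hτ₁ : 0 < N.τ₁) (hτ₂ : 0 < N.τ₂)
    (hT₁ : ∀ t ∈ T, 0 ≤ t → t - N.τ₁ ∈ T) (hT₂ : ∀ t ∈ T, 0 ≤ t → t - N.τ₂ ∈ T)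
    -- the transmittal delay; its shift commutes with the forward jump
    (β : ℝ) (hβ : 0 ≤ β) (hTβ : ∀ t ∈ T, 0 ≤ t → t - β ∈ T)
    (hσβ : ∀ t ∈ T, β ≤ t → TimeScale.sigma T (t - β) = TimeScale.sigma T t - β)
    -- the norm, the Lipschitz constants and the bounds
    (p : ℝ≥0∞) [Fact (1 ≤ p)] (hp : p = 1 ∨ p = 2 ∨ p = ∞)
    (c : CohenGrossberg.Consts) (hc : c.Admissible p N)
    (Z K : Matrix (Fin n) (Fin n) ℝ) (hZ : IsUnit Z)
    (hM : 0 < CohenGrossberg.M₁ p N c T Z K - CohenGrossberg.M₂ p N c Z)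
    (hreg : TimeScale.PosRegressive T fun _ => -CohenGrossberg.M₁ p N c T Z K) :
    N.ExpLagSync p T β K := by
  open TimeScale CohenGrossberg in
  rcases isEmpty_or_nonempty (Fin n) with hn | hn
  -- For `n = 0` the identity has norm `0` and `ω(W, h) = -1/h` has no finite limit, but the error
  -- vanishes.
  · refine ⟨1, one_pos, fun φ ψ x y _ _ _ _ => ⟨1, one_pos, fun t _ _ => ?_⟩⟩
    rw [Subsingleton.elim (y t - x (t - β)) 0, vnorm, WithLp.toLp_zero, norm_zero, one_mul]
    exact (Real.exp_pos _).le
  have hτ : 0 < N.τ := hτ₁.trans_le (le_max_left _ _)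
  -- At `ν = 0` the inequality is `M₂ < M₁`; it persists for small `ν > 0`.
  obtain ⟨ν, hν, hνM⟩ : ∃ ν > 0, M₂ p N c Z * Real.exp (ν * N.τ) + ν < M₁ p N c T Z K := by
    have hcont : Continuous fun ν : ℝ => M₂ p N c Z * Real.exp (ν * N.τ) + ν := by fun_prop
    have hev : ∀ᶠ ν in 𝓝[>] (0 : ℝ), M₂ p N c Z * Real.exp (ν * N.τ) + ν < M₁ p N c T Z K :=
      ((hcont.tendsto 0).mono_left nhdsWithin_le_nhds).eventually_lt_const
        (by simpa using sub_pos.1 hM)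
    obtain ⟨ν, h1, h2⟩ := (eventually_mem_nhdsWithin.and hev).exists
    exact ⟨ν, h1, h2⟩
  refine ⟨ν, hν, fun φ ψ x y hφ _ hx hy => ?_⟩
  set e : ℝ → Fin n → ℝ := fun s => y s - x (s - β) with he
  set v : ℝ → Fin n → ℝ := fun s => Z.mulVec (e s) with hv
  set W : Matrix (Fin n) (Fin n) ℝ := -(Z * K * Z⁻¹) with hW
  have hZ0 := mnorm_nonneg (p := p) Z
  have hZi0 := mnorm_nonneg (p := p) Z⁻¹
  have hZZ : Z⁻¹ * Z = 1 := Matrix.nonsing_inv_mul Z ((Matrix.isUnit_iff_isUnit_det Z).1 hZ)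
  have hev : ∀ s, vnorm p (e s) ≤ mnorm p Z⁻¹ * vnorm p (v s) := by
    intro s
    have h1 := vnorm_mulVec_le (p := p) Z⁻¹ (v s)
    rwa [hv, Matrix.mulVec_mulVec, hZZ, Matrix.one_mulVec] at h1
  have hve : ∀ s, vnorm p (v s) ≤ mnorm p Z * vnorm p (e s) := fun s => vnorm_mulVec_le Z (e s)
  have hder : ∀ t ∈ T, β ≤ t → HasDeltaDerivAt (T ∩ Ici β) v
      (W.mulVec (v t) + Z.mulVec (N.field T y t - N.field T x (t - β))) t := by
    intro t ht hβt
    have h1 := (Network.hasDeltaDerivAt_error hTβ hβ hσβ hx hy ht hβt).clm_apply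
      (LinearMap.toContinuousLinearMap (Matrix.mulVecLin Z))
    -- In the coordinates `Z u` the feedback `-K` becomes `W = -Z K Z⁻¹`.
    have h2 : ∀ f g u : Fin n → ℝ, Z.mulVec (f - K.mulVec u - g)
        = W.mulVec (Z.mulVec u) + Z.mulVec (f - g) := by
      intro f g u
      rw [hW, Matrix.mulVec_mulVec, Matrix.neg_mul, Matrix.mul_assoc, hZZ, Matrix.mul_one,
        Matrix.neg_mulVec, ← Matrix.mulVec_mulVec, Matrix.mulVec_sub, Matrix.mulVec_sub,
        Matrix.mulVec_sub]
      abel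
    rw [hv, ← h2]
    exact h1
  set A : ℝ := (c.MΓ * c.LΥ + c.MΥ * c.LΓ) + (c.MΓ * c.LF + c.MF * c.LΓ) * mnorm p N.P
    + c.LΓ * vnorm p N.bias with hA
  have hA0 : 0 ≤ A := by
    have := hc.LΓ_pos
    have := hc.LΥ_pos
    have := hc.LF_pos
    have := hc.MΓ_pos
    have := hc.MΥ_pos
    have := hc.MF_pos
    have := mnorm_nonneg (p := p) N.P
    have := vnorm_nonneg (p := p) N.bias
    positivity
  have hM₁ : M₁ p N c T Z K = -(unifiedMeasure p W T + mnorm p Z * mnorm p Z⁻¹ * A) := rfl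
  have hforce : ∀ t ∈ T, β + N.τ ≤ t → ∀ S,
      (∀ s ∈ T, t - N.τ ≤ s → s ≤ t → vnorm p (v s) ≤ S) →
      vnorm p (Z.mulVec (N.field T y t - N.field T x (t - β))) ≤
        mnorm p Z * mnorm p Z⁻¹ * A * vnorm p (v t) + M₂ p N c Z * S := by
    intro t ht hβt S hS
    have h1 := Network.vnorm_field_sub_le hc hT hβ hτ₁ hτ₂ hT₁ hT₂ hTβ hσβ hx hy ht hβt
      (S := mnorm p Z⁻¹ * S)
      (fun s hs h h' => (hev s).trans (mul_le_mul_of_nonneg_left (hS s hs h h') hZi0))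
    have h2 := mul_le_mul_of_nonneg_left (hev t) hA0
    refine (vnorm_mulVec_le _ _).trans ((mul_le_mul_of_nonneg_left
      (h1.trans (add_le_add_left h2 _)) hZ0).trans_eq ?_)
    unfold M₂
    ring
  -- From `β + τ` on, the whole window `[t-τ, t]` lies where the error equation holds. If `T` ends
  -- earlier, the bound on a compact interval already suffices.
  obtain ⟨t₁, hβt₁, ht₁⟩ : ∃ t₁, β + N.τ ≤ t₁ ∧ (t₁ ∈ T ∨ ∀ t ∈ T, t ≤ t₁) := by
    by_cases h : ∃ t ∈ T, β + N.τ ≤ t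
    · obtain ⟨t, ht, h⟩ := h
      exact ⟨t, h, Or.inl ht⟩
    · push Not at h
      exact ⟨_, le_rfl, Or.inr fun t ht => (h t ht).le⟩
  obtain ⟨B, hB0, hB⟩ := Network.exists_vnorm_error_le p hT hβ hτ.le hTβ hφ hx hy t₁
  -- The factor `e^{νt₁}` makes `C e^{-νs}` at least `‖Z‖ B + 1` for all `s ≤ t₁`; the `1` makes `C`
  -- positive.
  set C : ℝ := (mnorm p Z * B + 1) * Real.exp (ν * t₁) with hC
  have hC0 : 0 < C := by positivity
  have hinit : ∀ s ∈ T, 0 ≤ s → s ≤ t₁ → vnorm p (v s) ≤ C * Real.exp (-(ν * s)) := by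
    intro s hs h0s hst
    have h1 : 1 ≤ Real.exp (ν * t₁) * Real.exp (-(ν * s)) := by
      rw [← Real.exp_add]
      exact Real.one_le_exp (by nlinarith)
    have h2 := (hve s).trans (mul_le_mul_of_nonneg_left (hB s hs h0s hst) hZ0)
    have h3 : 0 ≤ mnorm p Z * B + 1 := by positivity
    rw [hC, mul_assoc]
    nlinarith
  have hdecay : ∀ t ∈ T, 0 ≤ t → vnorm p (v t) ≤ C * Real.exp (-(ν * t)) := by
    intro t ht h0t
    rcases le_total t t₁ with h | h
    · exact hinit t ht h0t h
    rcases ht₁ with ht₁ | ht₁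
    swap
    · exact hinit t ht h0t (ht₁ t ht)
    obtain ⟨D, -, hD⟩ := exists_vnorm_le p n
    have hβ' : β ≤ t₁ := by linarith
    refine halanay hT ht₁ (V := fun s => vnorm p (v s)) ?_ hC0 hτ.le hν.le hνM ?_ ?_ ?_ ?_ t ht h
    · have hvc : ContinuousOn v (T ∩ Ici t₁) := fun s hs =>
        ((hder s hs.1 (hβ'.trans hs.2)).continuousWithinAt ⟨hs.1, hβ'.trans hs.2⟩).mono
          (inter_subset_inter_right _ (Ici_subset_Ici.2 hβ'))
      exact ((PiLp.continuousLinearEquiv p ℝ fun _ : Fin n => ℝ).symm.continuous.comp_continuousOn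
        hvc).norm
    · intro t ht
      have := hreg t ht
      linarith
    · exact fun s hs h h' => hinit s hs (by linarith) h'
    · intro t ht htt S hS
      have h1 := vnorm_sigma_le (p := p) ht (hβ'.trans htt) (hder t ht (hβ'.trans htt))
      have h2 := mul_le_mul_of_nonneg_left (hforce t ht (hβt₁.trans htt) S hS) (mu_nonneg T t)
      rw [hM₁]
      linarith
    · intro t ht htt hσ S hS ε hε
      filter_upwards [eventually_vnorm_le (p := p) ht (hβ'.trans htt) hσ
        (hder t ht (hβ'.trans htt)) hε, self_mem_nhdsWithin] with s hs hs'
      have hst : 0 ≤ s - t := sub_nonneg.2 (le_of_lt hs'.2)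
      have h2 := mul_le_mul_of_nonneg_left (hforce t ht (hβt₁.trans htt) S hS) hst
      rw [hM₁]
      linarith
  refine ⟨mnorm p Z⁻¹ * C + 1, by positivity, fun t ht h0t => ?_⟩
  calc vnorm p (e t) ≤ mnorm p Z⁻¹ * (C * Real.exp (-(ν * t))) :=
        (hev t).trans (mul_le_mul_of_nonneg_left (hdecay t ht h0t) hZi0)
    _ ≤ (mnorm p Z⁻¹ * C + 1) * Real.exp (-(ν * t)) := by
        have := Real.exp_pos (-(ν * t))
        linarith
    _ ≤ _ := mul_le_mul_of_nonneg_left (exp_neg_le_texp_ominus T hν.le h0t) (by positivity)
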